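/- Let $M$ be a nonempty closed smooth manifold of dimension $n+1$ with $3\le n+1\le 7$, let $g$ be a smooth Riemannian metric on $M$, and let $c>0$. Let $\mathcal C(M)$ be the space of Caccioppoli sets of $(M,g)$, that is, of measurable sets $\Omega\subset M$ (up to null sets) whose boundary has finite mass $\mathbb M(\partial\Omega)=\|\partial\Omega\|(M)$, where for open $U\subset M$ $$\|\partial\Omega\|(U)=\sup\Big\{\int_\Omega \operatorname{div}_g X\,d\mathcal H^{n+1}\ :\ X \text{ a smooth vector field with compact support in } U,\ |X|_g\le 1\Big\}.$$ A sweepout is a map $\phi:[0,1]\to\mathcal C(M)$ that is continuous for the flat distance $\mathcal F(\Omega_1,\Omega_2)=\mathcal H^{n+1}(\Omega_1\triangle\Omega_2)$ and satisfies $\phi(0)=\emptyset$, $\phi(1)=M$ and $$\lim_{r\to0}\ \sup\{\|\partial\phi(x)\|(B_r(p)) : p\in M,\ x\in[0,1]\}=0,$$ where $B_r(p)$ is the open geodesic ball. Let $\Pi$ be the set of all sweepouts and put $$W^c(M,g)=\inf_{\phi\in\Pi}\ \sup_{x\in[0,1]}\big[\mathbb M(\partial\phi(x))-c\,\mathcal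 H^{n+1}(\phi(x))\big].$$ Then $W^c(M,g)$ is a positive real number: $0<W^c(M,g)<\infty$. -/

import Mathlib

open MeasureTheory Filter Set
open scoped Manifold Bundle ContDiff Topology ENNReal

noncomputable section

namespace CMCMinMax

/-- The model space of `d`-dimensional manifolds. -/
abbrev Model (d : ℕ) : Type := EuclideanSpace ℝ (Fin d)

/-- The smooth Riemannian metrics on a smooth manifold `M` of dimension `d`. -/
abbrev Metric (d : ℕ) (M : Type*) [TopologicalSpace M] [ChartedSpace (Model d) M]
    [IsManifold (𝓡 d) ∞ M] : Type _ :=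
  Bundle.ContMDiffRiemannianMetric (𝓡 d) ∞ (Model d) (fun x : M => TangentSpace (𝓡 d) x)

/-- The smooth vector fields on `M`. -/
abbrev VField (d : ℕ) (M : Type*) [TopologicalSpace M] [ChartedSpace (Model d) M]
    [IsManifold (𝓡 d) ∞ M] : Type _ :=
  ContMDiffSection (𝓡 d) (Model d) ∞ (fun x : M => TangentSpace (𝓡 d) x)

variable {d : ℕ} {M : Type*} [TopologicalSpace M] [ChartedSpace (Model d) M]
  [IsManifold (𝓡 d) ∞ M]

/-- The coordinate vector field `∂_i` of the chart at `p`, at the point with coordinates `y`. -/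
def coordVec (p : M) (y : Model d) (i : Fin d) :
    TangentSpace (𝓡 d) ((chartAt (Model d) p).symm y) :=
  mfderiv 𝓘(ℝ, Model d) (𝓡 d) (chartAt (Model d) p).symm y (EuclideanSpace.single i (1 : ℝ))

/-- The Gram matrix `g_ij` of the metric in the chart at `p`, in coordinates `y`. -/
def gram (g : Metric d M) (p : M) (y : Model d) : Matrix (Fin d) (Fin d) ℝ :=
  Matrix.of fun i j =>
    g.inner ((chartAt (Model d) p).symm y) (coordVec p y i) (coordVec p y j)

/-- The Riemannian volume density `√det(g_ij)` in the chart at `p`, in coordinates `y`. -/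
def density (g : Metric d M) (p : M) (y : Model d) : ℝ :=
  √(gram g p y).det

/-- The measure `√det(g_ij) dy` of the chart at `p`, carried over to the domain of the chart and
extended by zero to `M`. -/
def chartVolume [MeasurableSpace M] (g : Metric d M) (p : M) : Measure M :=
  ((volume.restrict (chartAt (Model d) p).target).withDensity
    (fun y => ENNReal.ofReal (density g p y))).map (chartAt (Model d) p).symm

/-- The Riemannian volume measure, i.e. the `d`-dimensional Hausdorff measure of `(M, g)`: the
least measure on `M` that dominates `√det(g_ij) dy` in each chart. As these local measures agree on
overlaps, it is the measure which is equal to `√det(g_ij) dy` in each chart. -/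
def vol [MeasurableSpace M] (g : Metric d M) : Measure M :=
  ⨆ p : M, chartVolume g p

/-- The components `X^i` of a vector field in the chart at `p`, in coordinates `y`. -/
def component (X : VField d M) (p : M) (y : Model d) (i : Fin d) : ℝ :=
  (show Model d from
    mfderiv (𝓡 d) 𝓘(ℝ, Model d) (chartAt (Model d) p) ((chartAt (Model d) p).symm y)
      (X ((chartAt (Model d) p).symm y))) i

/-- The Riemannian divergence `(1 / √det g) ∑ i, ∂_i (√det g X^i)`, computed at each point `p` in
the chart at `p` (the value does not depend on the chart). -/
def divergence (g : Metric d M) (X : VField d M) (p : M) : ℝ :=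
  (density g p (chartAt (Model d) p p))⁻¹ *
    ∑ i : Fin d, fderiv ℝ (fun y => density g p y * component X p y i)
      (chartAt (Model d) p p) (EuclideanSpace.single i (1 : ℝ))

/-- The admissible fields for the mass of a boundary in an open set `U`: smooth vector fields `X`
with compact support in `U` and `|X|_g ≤ 1`. -/
def testFields (g : Metric d M) (U : Set M) : Set (VField d M) :=
  {X | HasCompactSupport (fun p => (X p : Model d)) ∧
    tsupport (fun p => (X p : Model d)) ⊆ U ∧ ∀ p, g.inner p (X p) (X p) ≤ 1}

/-- The mass `‖∂Ω‖(U)` of the boundary of `Ω` in an open set `U`: the supremum of the numbers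
`∫_Ω div X` over all admissible fields `X`. -/
def boundaryMass [MeasurableSpace M] (g : Metric d M) (Ω U : Set M) : ℝ≥0∞ :=
  ⨆ X ∈ testFields g U, ENNReal.ofReal (∫ p in Ω, divergence g X p ∂(vol g))

/-- A Caccioppoli set of `(M, g)`: a measurable set whose boundary has finite mass. Sets which
differ by a null set represent the same element of the space of Caccioppoli sets; everything below
depends on the set only up to null sets. -/
structure CaccioppoliSet [MeasurableSpace M] (g : Metric d M) where
  /-- The underlying set. -/
  carrier : Set M
  measurableSet : MeasurableSet carrier
  finite_mass : boundaryMass g carrier univ < ⊤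

/-- The flat distance of two Caccioppoli sets: as they are of top dimension, it is the volume of
their symmetric difference. -/
def flatDist [MeasurableSpace M] {g : Metric d M} (Ω₁ Ω₂ : CaccioppoliSet g) : ℝ≥0∞ :=
  vol g (symmDiff Ω₁.carrier Ω₂.carrier)

/-- The open geodesic ball: the points at Riemannian distance less than `r` from `p`. -/
def geodesicBall (g : Metric d M) (p : M) (r : ℝ) : Set M :=
  letI : Bundle.RiemannianBundle (fun x : M => TangentSpace (𝓡 d) x) := ⟨g.toRiemannianMetric⟩
  {q | Manifold.riemannianEDist (𝓡 d) p q < ENNReal.ofReal r}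

/-- A sweepout: a path of Caccioppoli sets, continuous in the flat topology, that joins the zero
set to `M` and has no concentration of mass. -/
structure IsSweepout [MeasurableSpace M] (g : Metric d M)
    (φ : unitInterval → CaccioppoliSet g) : Prop where
  flat_continuous : ∀ t, Tendsto (fun s => flatDist (φ s) (φ t)) (𝓝 t) (𝓝 0)
  zero : (φ 0).carrier =ᵐ[vol g] (∅ : Set M)
  one : (φ 1).carrier =ᵐ[vol g] (univ : Set M)
  no_concentration :
    Tendsto (fun r : ℝ => ⨆ (p : M) (t : unitInterval),
      boundaryMass g (φ t).carrier (geodesicBall g p r)) (𝓝[>] 0) (𝓝 0)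

/-- The functional `𝒜^c(Ω) = M(∂Ω) - c Vol(Ω)`. -/
def areaFunctional [MeasurableSpace M] {g : Metric d M} (c : ℝ) (Ω : CaccioppoliSet g) : ℝ :=
  (boundaryMass g Ω.carrier univ).toReal - c * (vol g Ω.carrier).toReal

/-- The `𝒜^c`-min-max value `W^c(M, g)`, the infimum over all sweepouts `φ` of the supremum of
`𝒜^c` along `φ`, in the extended reals. -/
def minMaxValue [MeasurableSpace M] (g : Metric d M) (c : ℝ) : EReal :=
  ⨅ (φ : unitInterval → CaccioppoliSet g) (_ : IsSweepout g φ),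
    ⨆ t : unitInterval, (areaFunctional c (φ t) : EReal)

end CMCMinMax

end

/-!
The volume `Vol` is continuous along a sweepout and runs from `0` to `Vol(M)`, so every small value
`w` is attained along it.

*Positivity.* Sets of small volume have a boundary that is large in comparison with their volume:
for every `K` there is `v > 0` such that `Vol(Ω) ≤ v` implies `K Vol(Ω) ≤ M(∂Ω)`
(`exists_isoperimetric`). With `K = c + 1`, at a time with `Vol = w` the functional is at least
`(c + 1) w - c w = w`, and `w` depends on `(M, g)` and `c` only. The true isoperimetric inequality
is not needed. The weak one is proved in a chart by exhibiting a test field: if the indicator of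
`Ω` in a cube is approximated by a smooth `f`, there is a field `F` with
`div F ≥ f - κ ∫ f`, all of whose components are at most a prescribed `ε`
(`exists_field_euclDiv_ge`). For a set of small volume, the flux of `F` out of it is then
comparable with its volume, and `F / ε` is an admissible field up to a constant of the metric.

*Finiteness.* It is enough to construct one sweepout with boundaries of bounded mass. `M` is
covered by finitely many coordinate cubes, which are shrunk simultaneously by the factor
`t ∈ [0, 1]`; the sweepout is the union of the shrunk cubes (`exists_isSweepout`). Taking the union
with a cube adds to the mass of the boundary in `U` at most the area of the part of the boundary of
the cube in `U` (`exists_boundaryMass_union_le`), which is proved by replacing the indicator of the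
cube with smooth cutoff functions. If `U` lies in a cube of half-side `δ` in the chart, this area
is of order `δ ^ (d - 1)`. For `d ≥ 2` it tends to zero as `δ` does, so there is no concentration of
mass.

Both parts rest on the description of the volume and of the divergence in the charts, and on the
divergence theorem for fields that are supported in a chart (`integral_divergence_eq_zero`).
-/

set_option linter.unusedSectionVars false

namespace CMCMinMax

/-! ### Riemannian metrics and vector fields in a chart -/

section Geometry

variable {d : ℕ} {M : Type*} [TopologicalSpace M] [ChartedSpace (Model d) M]
  [IsManifold (𝓡 d) ∞ M]

local notation "φ[" p "]" => chartAt (Model d) p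

/-- The derivative of the inverse of the chart at `p`, with the tangent spaces of `M` read as the
model space. -/
noncomputable def pushMap (p : M) (y : Model d) : Model d →L[ℝ] Model d :=
  mfderiv 𝓘(ℝ, Model d) (𝓡 d) (φ[p]).symm y

/-- The derivative of the chart at `p`, with the tangent spaces of `M` read as the model space. -/
noncomputable def pullMap (p q : M) : Model d →L[ℝ] Model d :=
  mfderiv (𝓡 d) 𝓘(ℝ, Model d) φ[p] q

/-- The metric at a point as a bilinear form on the model space. -/
noncomputable def metricForm (g : Metric d M) (q : M) : Model d →L[ℝ] Model d →L[ℝ] ℝ := g.inner q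

lemma contMDiffOn_push (p : M) {F : Model d → Model d} {s : Set (Model d)}
    (hF : ContDiffOn ℝ ∞ F s) (hs : s ⊆ (φ[p]).target) :
    ContMDiffOn 𝓘(ℝ, Model d) ((𝓡 d).prod 𝓘(ℝ, Model d)) ∞
      (fun y => (⟨(φ[p]).symm y, pushMap p y (F y)⟩ :
        TangentBundle (𝓡 d) M)) s := by
  have h0 : ContMDiffOn 𝓘(ℝ, Model d) (𝓡 d) ∞ (φ[p]).symm (φ[p]).target :=
    contMDiffOn_chart_symm (I := 𝓡 d) (n := ∞) (x := p)
  have h1 := h0.contMDiffOn_tangentMapWithin (m := ∞) (n := ∞)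
    (by simp) (φ[p]).open_target.uniqueMDiffOn
  have h2 : ContMDiffOn 𝓘(ℝ, Model d) (𝓘(ℝ, Model d).prod 𝓘(ℝ, Model d)) ∞
      (fun y => (⟨y, F y⟩ : TangentBundle 𝓘(ℝ, Model d) (Model d))) s := fun y hy =>
    contMDiffWithinAt_vectorSpace_iff_contDiffWithinAt.2 (hF y hy)
  refine (h1.comp h2 (fun y hy => hs hy)).congr fun y hy => ?_
  simp only [Function.comp, tangentMapWithin]
  rw [mfderivWithin_of_isOpen (φ[p]).open_target (hs hy)]
  rfl

lemma contMDiffOn_inner (g : Metric d M) {N : Type*} {E H : Type*} [NormedAddCommGroup E]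
    [NormedSpace ℝ E] [TopologicalSpace H] {I : ModelWithCorners ℝ E H} [TopologicalSpace N]
    [ChartedSpace H N] {s : Set N} {b : N → M} {v w : ∀ x, TangentSpace (𝓡 d) (b x)}
    (hv : ContMDiffOn I ((𝓡 d).prod 𝓘(ℝ, Model d)) ∞
      (fun x => (⟨b x, v x⟩ : TangentBundle (𝓡 d) M)) s)
    (hw : ContMDiffOn I ((𝓡 d).prod 𝓘(ℝ, Model d)) ∞
      (fun x => (⟨b x, w x⟩ : TangentBundle (𝓡 d) M)) s) :
    ContMDiffOn I 𝓘(ℝ) ∞ (fun x => g.inner (b x) (v x) (w x)) s := by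
  let _ : Bundle.RiemannianBundle (fun x : M => TangentSpace (𝓡 d) x) := ⟨g.toRiemannianMetric⟩
  exact ContMDiffOn.inner_bundle (n := ∞) (E := fun x : M => TangentSpace (𝓡 d) x) hv hw

lemma gram_apply (g : Metric d M) (p : M) (y : Model d) (i j : Fin d) :
    gram g p y i j = metricForm g ((φ[p]).symm y) (pushMap p y (EuclideanSpace.single i 1))
      (pushMap p y (EuclideanSpace.single j 1)) := rfl

lemma contDiffOn_gram (g : Metric d M) (p : M) (i j : Fin d) :
    ContDiffOn ℝ ∞ (fun y => gram g p y i j) (φ[p]).target :=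
  contMDiffOn_iff_contDiffOn.1
    (contMDiffOn_inner g (contMDiffOn_push p contDiffOn_const Subset.rfl)
      (contMDiffOn_push p contDiffOn_const Subset.rfl))

lemma pullMap_pushMap (p : M) {y : Model d} (hy : y ∈ (φ[p]).target) (v : Model d) :
    pullMap p ((φ[p]).symm y) (pushMap p y v) = v := by
  have := (mdifferentiable_chart (I := 𝓡 d) p).comp_symm_deriv hy
  exact congrArg (fun L : Model d →L[ℝ] Model d => L v) this

lemma pushMap_pullMap (p : M) {q : M} (hq : q ∈ (φ[p]).source) (v : Model d) :
    pushMap p (φ[p] q) (pullMap p q v) = v := by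
  have := (mdifferentiable_chart (I := 𝓡 d) p).symm_comp_deriv hq
  exact congrArg (fun L : Model d →L[ℝ] Model d => L v) this

lemma eq_sum_single (v : Model d) : v = ∑ i, v i • EuclideanSpace.single i (1 : ℝ) := by
  ext j
  simp [Finset.sum_apply, Pi.single_apply]

lemma metricForm_pushMap (g : Metric d M) (p : M) (y v w : Model d) :
    metricForm g ((φ[p]).symm y) (pushMap p y v) (pushMap p y w) =
      ∑ i, ∑ j, v i * w j * gram g p y i j := by
  conv_lhs => rw [eq_sum_single v, eq_sum_single w]
  simp only [map_sum, map_smul, FunLike.coe_sum, Finset.sum_apply,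
    _root_.smul_apply, gram_apply, smul_eq_mul, Finset.mul_sum, mul_assoc]
  rw [Finset.sum_comm]
  exact Finset.sum_congr rfl fun i _ => Finset.sum_congr rfl fun j _ => by ring

lemma metricForm_pos (g : Metric d M) (q : M) {v : Model d} (hv : v ≠ 0) :
    0 < metricForm g q v v := g.pos q v hv

lemma metricForm_symm (g : Metric d M) (q : M) (v w : Model d) :
    metricForm g q v w = metricForm g q w v := g.symm q v w

lemma pushMap_ne_zero (p : M) {y : Model d} (hy : y ∈ (φ[p]).target) {v : Model d} (hv : v ≠ 0) :
    pushMap p y v ≠ 0 := by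
  intro h
  apply hv
  rw [← pullMap_pushMap p hy v, h, map_zero]

lemma gram_posDef (g : Metric d M) (p : M) {y : Model d} (hy : y ∈ (φ[p]).target) :
    (gram g p y).PosDef := by
  refine Matrix.PosDef.of_dotProduct_mulVec_pos ?_ ?_
  · ext i j
    simpa [gram_apply] using metricForm_symm g _ _ _
  · intro v hv
    have h0 : WithLp.toLp 2 v ≠ (0 : Model d) := by
      intro h; exact hv (by simpa using congrArg WithLp.ofLp h)
    have := metricForm_pos g ((φ[p]).symm y) (pushMap_ne_zero p hy h0)
    rw [metricForm_pushMap] at this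
    refine lt_of_lt_of_eq this ?_
    simp [dotProduct, Matrix.mulVec, Finset.mul_sum, mul_comm, mul_left_comm]

lemma det_gram_pos (g : Metric d M) (p : M) {y : Model d} (hy : y ∈ (φ[p]).target) :
    0 < (gram g p y).det := (gram_posDef g p hy).det_pos

lemma density_pos (g : Metric d M) (p : M) {y : Model d} (hy : y ∈ (φ[p]).target) :
    0 < density g p y := Real.sqrt_pos.2 (det_gram_pos g p hy)

lemma contDiffOn_density (g : Metric d M) (p : M) :
    ContDiffOn ℝ ∞ (density g p) (φ[p]).target := by
  have : ContDiffOn ℝ ∞ (fun y => (gram g p y).det) (φ[p]).target := by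
    simp only [Matrix.det_apply]
    refine ContDiffOn.sum fun σ _ => ContDiffOn.const_smul _ ?_
    exact contDiffOn_prod fun i _ => contDiffOn_gram g p _ _
  exact this.sqrt fun y hy => (det_gram_pos g p hy).ne'

/-- The coordinates of the field `X` in the chart at `p`, as a vector of the model space. -/
noncomputable def coordField (X : VField d M) (p : M) (y : Model d) : Model d :=
  pullMap p ((φ[p]).symm y) (X ((φ[p]).symm y))

lemma pushMap_coordField (X : VField d M) (p : M) {q : M} (hq : q ∈ (φ[p]).source) :
    pushMap p (φ[p] q) (coordField X p (φ[p] q)) = X q := by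
  rw [coordField, (φ[p]).left_inv hq]
  exact pushMap_pullMap p hq _

lemma contDiffOn_coordField (X : VField d M) (p : M) :
    ContDiffOn ℝ ∞ (coordField X p) (φ[p]).target := by
  have h0 : ContMDiffOn 𝓘(ℝ, Model d) (𝓡 d) ∞ (φ[p]).symm (φ[p]).target :=
    contMDiffOn_chart_symm (I := 𝓡 d) (n := ∞) (x := p)
  have h1 : ContMDiffOn (𝓡 d) 𝓘(ℝ, Model d) ∞ φ[p] (φ[p]).source :=
    contMDiffOn_chart (I := 𝓡 d) (n := ∞) (x := p)
  have h2 := h1.contMDiffOn_tangentMapWithin (m := ∞) (n := ∞)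
    (by simp) (φ[p]).open_source.uniqueMDiffOn
  have h3 := h2.comp (X.contMDiff.comp_contMDiffOn h0) (fun y hy => (φ[p]).map_target hy)
  intro y hy
  have h4 := (h3 y hy).congr (f₁ := fun y => (⟨φ[p] ((φ[p]).symm y), coordField X p y⟩ :
      TangentBundle 𝓘(ℝ, Model d) (Model d))) (fun z hz => by
        simp only [Function.comp, tangentMapWithin]
        rw [mfderivWithin_of_isOpen (φ[p]).open_source ((φ[p]).map_target hz)]
        rfl) (by
        simp only [Function.comp, tangentMapWithin]
        rw [mfderivWithin_of_isOpen (φ[p]).open_source ((φ[p]).map_target hy)]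
        rfl)
  have h5 := h4.congr (f₁ := fun y => (⟨y, coordField X p y⟩ :
      TangentBundle 𝓘(ℝ, Model d) (Model d))) (fun z hz => by
        rw [(φ[p]).right_inv hz]) (by rw [(φ[p]).right_inv hy])
  exact contMDiffWithinAt_vectorSpace_iff_contDiffWithinAt.1 h5

end Geometry

/-! ### Change of charts -/

section Transition

variable {d : ℕ} {M : Type*} [TopologicalSpace M] [ChartedSpace (Model d) M]
  [IsManifold (𝓡 d) ∞ M]

local notation "φ[" p "]" => chartAt (Model d) p

/-- The transition map from the chart at `p` to the chart at `q`. -/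
noncomputable def transition (p q : M) (y : Model d) : Model d := φ[q] ((φ[p]).symm y)

/-- The domain, in the chart at `p`, of the transition map to the chart at `q`. -/
def overlap (p q : M) : Set (Model d) := (φ[p]).target ∩ (φ[p]).symm ⁻¹' (φ[q]).source

lemma isOpen_overlap (p q : M) : IsOpen (overlap (d := d) p q) :=
  (φ[p]).symm.isOpen_inter_preimage (φ[q]).open_source

lemma transition_mem (p q : M) {y : Model d} (hy : y ∈ overlap p q) :
    transition p q y ∈ overlap q p := by
  refine ⟨(φ[q]).map_source hy.2, ?_⟩
  simp only [transition, mem_preimage, (φ[q]).left_inv hy.2]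
  exact (φ[p]).map_target hy.1

lemma symm_transition (p q : M) {y : Model d} (hy : y ∈ overlap p q) :
    (φ[q]).symm (transition p q y) = (φ[p]).symm y := (φ[q]).left_inv hy.2

lemma transition_transition (p q : M) {y : Model d} (hy : y ∈ overlap p q) :
    transition q p (transition p q y) = y := by
  rw [transition, symm_transition p q hy, (φ[p]).right_inv hy.1]

lemma contDiffOn_transition (p q : M) : ContDiffOn ℝ ∞ (transition (d := d) p q) (overlap p q) := by
  rw [← contMDiffOn_iff_contDiffOn]
  have h0 : ContMDiffOn 𝓘(ℝ, Model d) (𝓡 d) ∞ (φ[p]).symm (φ[p]).target :=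
    contMDiffOn_chart_symm (I := 𝓡 d) (n := ∞) (x := p)
  have h1 : ContMDiffOn (𝓡 d) 𝓘(ℝ, Model d) ∞ φ[q] (φ[q]).source :=
    contMDiffOn_chart (I := 𝓡 d) (n := ∞) (x := q)
  exact h1.comp (h0.mono inter_subset_left) (fun y hy => hy.2)

lemma hasFDerivAt_transition (p q : M) {y : Model d} (hy : y ∈ overlap p q) :
    HasFDerivAt (transition p q) ((pullMap q ((φ[p]).symm y)).comp (pushMap p y)) y := by
  have h0 := ((mdifferentiable_chart (I := 𝓡 d) p).mdifferentiableAt_symm hy.1).hasMFDerivAt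
  have h1 := ((mdifferentiable_chart (I := 𝓡 d) q).mdifferentiableAt hy.2).hasMFDerivAt
  exact (h1.comp y h0).hasFDerivAt

lemma fderiv_transition (p q : M) {y : Model d} (hy : y ∈ overlap p q) :
    fderiv ℝ (transition p q) y = (pullMap q ((φ[p]).symm y)).comp (pushMap p y) :=
  (hasFDerivAt_transition p q hy).fderiv

lemma pushMap_transition (p q : M) {y : Model d} (hy : y ∈ overlap p q) (v : Model d) :
    pushMap q (transition p q y) (fderiv ℝ (transition p q) y v) = pushMap p y v := by
  rw [fderiv_transition p q hy]
  exact pushMap_pullMap q hy.2 _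

lemma coordField_transition (X : VField d M) (p q : M) {y : Model d} (hy : y ∈ overlap p q) :
    coordField X q (transition p q y) = fderiv ℝ (transition p q) y (coordField X p y) := by
  have h := pushMap_coordField X p ((φ[p]).map_target hy.1)
  rw [(φ[p]).right_inv hy.1] at h
  rw [fderiv_transition p q hy, ContinuousLinearMap.comp_apply, h, coordField,
    symm_transition p q hy]

lemma fderiv_transition_comp (p q : M) {y : Model d} (hy : y ∈ overlap p q) :
    (fderiv ℝ (transition q p) (transition p q y)).comp (fderiv ℝ (transition p q) y) =
      ContinuousLinearMap.id ℝ (Model d) := by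
  have h := (hasFDerivAt_transition q p (transition_mem p q hy)).comp y
    (hasFDerivAt_transition p q hy)
  have h2 : HasFDerivAt (transition q p ∘ transition p q) (ContinuousLinearMap.id ℝ (Model d)) y :=
    (hasFDerivAt_id y).congr_of_eventuallyEq <| by
      filter_upwards [(isOpen_overlap p q).mem_nhds hy] with z hz
      exact transition_transition p q hz
  rw [fderiv_transition p q hy, fderiv_transition q p (transition_mem p q hy)]
  exact h.unique h2

lemma det_fderiv_transition_ne_zero (p q : M) {y : Model d} (hy : y ∈ overlap p q) :
    (fderiv ℝ (transition p q) y).det ≠ 0 := by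
  intro h
  have := congrArg ContinuousLinearMap.det (fderiv_transition_comp p q hy)
  have h2 : LinearMap.det ((fderiv ℝ (transition q p) (transition p q y)).comp
      (fderiv ℝ (transition p q) y) : Model d →ₗ[ℝ] Model d) = 1 := by
    rw [fderiv_transition_comp p q hy]; simp
  rw [ContinuousLinearMap.toLinearMap_comp, LinearMap.det_comp] at h2
  have h3 : LinearMap.det (fderiv ℝ (transition p q) y : Model d →ₗ[ℝ] Model d) = 0 := h
  rw [h3, mul_zero] at h2
  exact zero_ne_one h2

lemma density_transition (g : Metric d M) (p q : M) {y : Model d} (hy : y ∈ overlap p q) :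
    density g p y = |(fderiv ℝ (transition p q) y).det| * density g q (transition p q y) := by
  set L := fderiv ℝ (transition p q) y with hL
  set b := (EuclideanSpace.basisFun (Fin d) ℝ).toBasis
  set A := LinearMap.toMatrix b b (L : Model d →ₗ[ℝ] Model d) with hA
  have hentry : ∀ i j, A i j = L (EuclideanSpace.single j 1) i := by
    intro i j
    simp [hA, b, LinearMap.toMatrix_apply]
  have hgram : gram g p y = A.transpose * gram g q (transition p q y) * A := by
    ext i j
    rw [gram_apply, ← pushMap_transition p q hy, ← pushMap_transition p q hy,
      ← symm_transition p q hy, metricForm_pushMap, ← hL]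
    simp only [Matrix.mul_apply, Matrix.transpose_apply, hentry, Finset.sum_mul]
    rw [Finset.sum_comm]
    exact Finset.sum_congr rfl fun i _ => Finset.sum_congr rfl fun j _ => by ring
  have hdet : A.det = L.det := LinearMap.det_toMatrix b _
  rw [density, density, hgram, Matrix.det_mul, Matrix.det_mul, Matrix.det_transpose, hdet,
    mul_right_comm, ← sq, Real.sqrt_mul (sq_nonneg _), Real.sqrt_sq_eq_abs]

end Transition

/-! ### The Euclidean divergence under a change of coordinates -/

section Piola

variable {d : ℕ}

/-- The divergence of a field on the model space, with respect to Lebesgue measure. -/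
noncomputable def euclDiv (W : Model d → Model d) (y : Model d) : ℝ :=
  ∑ i : Fin d, fderiv ℝ (fun z => W z i) y (EuclideanSpace.single i (1 : ℝ))

lemma trace_eq_sum (L : Model d →ₗ[ℝ] Model d) :
    LinearMap.trace ℝ (Model d) L = ∑ i, L (EuclideanSpace.single i 1) i := by
  rw [LinearMap.trace_eq_matrix_trace ℝ (EuclideanSpace.basisFun (Fin d) ℝ).toBasis, Matrix.trace]
  simp [LinearMap.toMatrix_apply]

lemma fderiv_coord {W : Model d → Model d} {y : Model d} (hW : DifferentiableAt ℝ W y) (i : Fin d)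
    (v : Model d) : fderiv ℝ (fun z => W z i) y v = fderiv ℝ W y v i := by
  have h := ((EuclideanSpace.proj i : Model d →L[ℝ] ℝ).hasFDerivAt.comp y hW.hasFDerivAt).fderiv
  exact congrArg (fun L : Model d →L[ℝ] ℝ => L v) h

lemma euclDiv_eq_trace {W : Model d → Model d} {y : Model d} (hW : DifferentiableAt ℝ W y) :
    euclDiv W y = LinearMap.trace ℝ (Model d) (fderiv ℝ W y) := by
  rw [trace_eq_sum]
  exact Finset.sum_congr rfl fun i _ => fderiv_coord hW i _

lemma contDiff_det : ContDiff ℝ ∞ (fun L : Model d →L[ℝ] Model d => L.det) := by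
  have h : (fun L : Model d →L[ℝ] Model d => L.det) = fun L =>
      (Matrix.of fun i j => L (EuclideanSpace.single j 1) i).det := by
    ext L
    rw [ContinuousLinearMap.det,
      ← LinearMap.det_toMatrix (EuclideanSpace.basisFun (Fin d) ℝ).toBasis]
    congr 1
  rw [h]
  simp only [Matrix.det_apply, Matrix.of_apply]
  refine ContDiff.sum fun σ _ => ContDiff.const_smul _ (contDiff_prod fun i _ => ?_)
  have h1 : ContDiff ℝ ∞ (fun L : Model d →L[ℝ] Model d => L (EuclideanSpace.single i 1)) :=
    (ContinuousLinearMap.apply ℝ (Model d) (EuclideanSpace.single i (1:ℝ) : Model d)).contDiff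
  exact (EuclideanSpace.proj (σ i) : Model d →L[ℝ] ℝ).contDiff.comp h1

/-- Jacobi's formula at the identity. -/
lemma fderiv_det_id (H : Model d →L[ℝ] Model d) :
    fderiv ℝ (fun L : Model d →L[ℝ] Model d => L.det) (ContinuousLinearMap.id ℝ (Model d)) H =
      LinearMap.trace ℝ (Model d) H := by
  have h1 : HasDerivAt (fun t : ℝ => (ContinuousLinearMap.id ℝ (Model d) + t • H).det)
      (fderiv ℝ (fun L : Model d →L[ℝ] Model d => L.det) (ContinuousLinearMap.id ℝ (Model d)) H)
      0 := by
    have h2 : HasDerivAt (fun t : ℝ => ContinuousLinearMap.id ℝ (Model d) + t • H) H 0 := by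
      simpa using ((hasDerivAt_id (0:ℝ)).smul_const H).const_add (ContinuousLinearMap.id ℝ (Model d))
    have h3 := (contDiff_det (d := d)).differentiable (by simp)
      (ContinuousLinearMap.id ℝ (Model d))
    refine HasFDerivAt.comp_hasDerivAt_of_eq (0:ℝ) h3.hasFDerivAt h2 ?_
    exact (add_eq_left.2 (zero_smul ℝ H)).symm
  set b := (EuclideanSpace.basisFun (Fin d) ℝ).toBasis
  set A := LinearMap.toMatrix b b (H : Model d →ₗ[ℝ] Model d)
  have h4 : ∀ t : ℝ, (ContinuousLinearMap.id ℝ (Model d) + t • H).det = (1 + t • A).det := by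
    intro t
    rw [ContinuousLinearMap.det, ← LinearMap.det_toMatrix b]
    simp [A]
  have h6 := funext fun t : ℝ => (h4 t).trans (Matrix.det_one_add_smul t A)
  rw [h6] at h1
  rw [LinearMap.trace_eq_matrix_trace ℝ b]
  refine h1.unique ?_
  have h5 := (((hasDerivAt_id (0:ℝ)).const_mul (Matrix.trace A)).const_add 1).add
    ((((1 + (Polynomial.X : Polynomial ℝ) • A.map (⇑Polynomial.C)).det.divX.divX).hasDerivAt 0).mul
      (hasDerivAt_pow 2 (0:ℝ)))
  refine HasDerivAt.congr_deriv h5 ?_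
  simp
  rfl

/-- Jacobi's formula: the derivative of the determinant at an invertible map. -/
lemma fderiv_det {A B : Model d →L[ℝ] Model d} (hBA : B.comp A = ContinuousLinearMap.id ℝ (Model d))
    (H : Model d →L[ℝ] Model d) :
    fderiv ℝ (fun L : Model d →L[ℝ] Model d => L.det) A H =
      A.det * LinearMap.trace ℝ (Model d) (B.comp H : Model d →L[ℝ] Model d) := by
  have hdet : ∀ K L : Model d →L[ℝ] Model d, (K.comp L).det = K.det * L.det := by
    intro K L
    simp only [ContinuousLinearMap.det, ContinuousLinearMap.toLinearMap_comp, LinearMap.det_comp]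
  have hA : A.det * B.det = 1 := by
    rw [mul_comm, ← hdet, hBA]; simp [ContinuousLinearMap.det]
  have h1 : (fun L : Model d →L[ℝ] Model d => L.det) =
      fun L => A.det * (ContinuousLinearMap.compL ℝ (Model d) (Model d) (Model d) B L).det := by
    ext L
    rw [ContinuousLinearMap.compL_apply, hdet, ← mul_assoc, hA, one_mul]
  have hd := fun K => (contDiff_det (d := d)).differentiable (by simp) K
  have h2 : HasFDerivAt (fun L : Model d →L[ℝ] Model d =>
      (ContinuousLinearMap.compL ℝ (Model d) (Model d) (Model d) B L).det)
      ((fderiv ℝ (fun L : Model d →L[ℝ] Model d => L.det) (ContinuousLinearMap.id ℝ (Model d))).comp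
        (ContinuousLinearMap.compL ℝ (Model d) (Model d) (Model d) B)) A := by
    have := (hd (ContinuousLinearMap.compL ℝ (Model d) (Model d) (Model d) B A)).hasFDerivAt.comp A
      (ContinuousLinearMap.compL ℝ (Model d) (Model d) (Model d) B).hasFDerivAt
    rw [ContinuousLinearMap.compL_apply, hBA] at this
    exact this
  rw [h1, (h2.const_mul A.det).fderiv]
  simp [fderiv_det_id]

/-- The Piola identity: if `ψ` carries the field `Y` to `W`, then it carries the divergence of
`|det Dψ| Y` to that of `W`, up to the factor `|det Dψ|`. The terms with second derivatives of `ψ`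
cancel because `D²ψ` is symmetric. -/
lemma euclDiv_piola {ψ W Y : Model d → Model d} {y : Model d} (hψ : ContDiffAt ℝ 2 ψ y)
    {B : Model d →L[ℝ] Model d} (hB : B.comp (fderiv ℝ ψ y) = ContinuousLinearMap.id ℝ (Model d))
    (hY : DifferentiableAt ℝ Y y) (hW : DifferentiableAt ℝ W (ψ y))
    (h : ∀ᶠ x in 𝓝 y, fderiv ℝ ψ x (Y x) = W (ψ x)) :
    euclDiv (fun x => |(fderiv ℝ ψ x).det| • Y x) y =
      |(fderiv ℝ ψ y).det| * euclDiv W (ψ y) := by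
  set A := fderiv ℝ ψ y with hA
  have hdet : A.det ≠ 0 := by
    intro h0
    have h1 : LinearMap.det (B.comp A : Model d →ₗ[ℝ] Model d) = 1 := by rw [hB]; simp
    rw [ContinuousLinearMap.toLinearMap_comp, LinearMap.det_comp] at h1
    have h2 : LinearMap.det (A : Model d →ₗ[ℝ] Model d) = 0 := h0
    rw [h2, mul_zero] at h1
    exact zero_ne_one h1
  have hψ' : DifferentiableAt ℝ (fderiv ℝ ψ) y :=
    (hψ.fderiv_right (m := 1) (by norm_num)).differentiableAt (by simp)
  set D2 := fderiv ℝ (fderiv ℝ ψ) y with hD2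
  have hsymm : ∀ v w, D2 v w = D2 w v := fun v w => hψ.isSymmSndFDerivAt (by simp) v w
  set DY := fderiv ℝ Y y with hDY
  set DW := fderiv ℝ W (ψ y) with hDW
  -- Differentiating `Dψ Y = W ∘ ψ` expresses `DY` through `DW` and `D²ψ`.
  have hY' : DY = B.comp (DW.comp A) - B.comp (D2 (Y y)) := by
    have h1 := hψ'.hasFDerivAt.clm_apply hY.hasFDerivAt
    have h2 := hW.hasFDerivAt.comp y (hψ.differentiableAt (by simp)).hasFDerivAt
    have h3 := (h2.congr_of_eventuallyEq h).unique h1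
    ext1 v
    have h4 := congrArg (fun L : Model d →L[ℝ] Model d => B (L v)) h3
    have h5 : ∀ w, B (A w) = w := fun w => congrArg (fun L : Model d →L[ℝ] Model d => L w) hB
    simp only [ContinuousLinearMap.comp_apply, add_apply, map_add, ← hA,
      ContinuousLinearMap.flip_apply, ← hD2, ← hDY, ← hDW, h5, hsymm v (Y y)] at h4
    simp only [sub_apply, ContinuousLinearMap.comp_apply, h4]
    abel
  have htr : LinearMap.trace ℝ (Model d) DY = LinearMap.trace ℝ (Model d) DW -
      LinearMap.trace ℝ (Model d) (B.comp (D2 (Y y)) : Model d →L[ℝ] Model d) := by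
    have h1 : LinearMap.trace ℝ (Model d) (B.comp (DW.comp A) : Model d →L[ℝ] Model d) =
        LinearMap.trace ℝ (Model d) DW := by
      have h2 := LinearMap.trace_mul_comm ℝ (B : Model d →ₗ[ℝ] Model d)
        ((DW : Model d →ₗ[ℝ] Model d) * (A : Model d →ₗ[ℝ] Model d))
      have h3 : (A : Model d →ₗ[ℝ] Model d) * (B : Model d →ₗ[ℝ] Model d) = 1 := by
        rw [mul_eq_one_comm]
        exact congrArg (fun L : Model d →L[ℝ] Model d => (L : Model d →ₗ[ℝ] Model d)) hB
      rw [mul_assoc, h3, mul_one] at h2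
      exact h2
    rw [hY', ContinuousLinearMap.toLinearMap_sub, map_sub, h1]
  have hJ : HasFDerivAt (fun x => (fderiv ℝ ψ x).det)
      ((fderiv ℝ (fun L : Model d →L[ℝ] Model d => L.det) A).comp D2) y :=
    HasFDerivAt.comp y ((contDiff_det (d := d)).differentiable (by simp) A).hasFDerivAt
      hψ'.hasFDerivAt
  have hZ := (hJ.smul hY.hasFDerivAt).const_smul (SignType.sign A.det : ℝ)
  -- The determinant has constant sign near `y`.
  have hsign : (fun x => |(fderiv ℝ ψ x).det| • Y x) =ᶠ[𝓝 y]
      fun x => (SignType.sign A.det : ℝ) • ((fderiv ℝ ψ x).det • Y x) := by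
    rcases lt_or_gt_of_ne hdet with h0 | h0
    · filter_upwards [hJ.continuousAt.eventually_lt continuousAt_const h0] with x hx
      rw [abs_of_neg hx, sign_neg h0]
      simp
    · filter_upwards [continuousAt_const.eventually_lt hJ.continuousAt h0] with x hx
      rw [abs_of_pos hx, sign_pos h0]
      simp
  have hZ' := hZ.congr_of_eventuallyEq hsign
  rw [euclDiv_eq_trace hZ'.differentiableAt, euclDiv_eq_trace hW, hZ'.fderiv, ← sign_mul_self]
  simp only [ContinuousLinearMap.toLinearMap_smul, ContinuousLinearMap.toLinearMap_add, map_add,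
    map_smul, smul_eq_mul, ← hDY, htr, ← hDW, mul_assoc, ← hA]
  congr 1
  have h7 : ∀ L : Model d →L[ℝ] ℝ,
      LinearMap.trace ℝ (Model d) (L.smulRight (Y y) : Model d →L[ℝ] Model d) = L (Y y) := by
    intro L
    rw [trace_eq_sum]
    conv_rhs => rw [eq_sum_single (Y y)]
    simp [mul_comm]
  rw [h7, ContinuousLinearMap.comp_apply, fderiv_det hB]
  ring

end Piola

/-! ### The Riemannian divergence in a chart -/

section DivergenceChart

variable {d : ℕ} {M : Type*} [TopologicalSpace M] [ChartedSpace (Model d) M]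
  [IsManifold (𝓡 d) ∞ M]

local notation "φ[" p "]" => chartAt (Model d) p

/-- The field `√det g X` of the chart at `p`, whose Euclidean divergence is `√det g div X`. -/
noncomputable def weightedField (g : Metric d M) (X : VField d M) (p : M) (y : Model d) : Model d :=
  density g p y • coordField X p y

lemma contDiffOn_weightedField (g : Metric d M) (X : VField d M) (p : M) :
    ContDiffOn ℝ ∞ (weightedField g X p) (φ[p]).target :=
  (contDiffOn_density g p).smul (contDiffOn_coordField X p)

lemma contDiffAt_weightedField (g : Metric d M) (X : VField d M) (p : M) {y : Model d}
    (hy : y ∈ (φ[p]).target) : ContDiffAt ℝ ∞ (weightedField g X p) y :=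
  (contDiffOn_weightedField g X p).contDiffAt ((φ[p]).open_target.mem_nhds hy)

lemma divergence_eq (g : Metric d M) (X : VField d M) (q : M) :
    divergence g X q = (density g q (φ[q] q))⁻¹ * euclDiv (weightedField g X q) (φ[q] q) := rfl

/-- The transformation law of `∑ i, ∂_i (√det g X^i)` under a change of charts, by the Piola identity
for the transition map. -/
lemma euclDiv_weightedField_transition (g : Metric d M) (X : VField d M) (p q : M) {y : Model d}
    (hy : y ∈ overlap p q) :
    euclDiv (weightedField g X p) y = |(fderiv ℝ (transition p q) y).det| *
      euclDiv (weightedField g X q) (transition p q y) := by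
  have hopen := (isOpen_overlap p q).mem_nhds hy
  have hψ : ContDiffAt ℝ ∞ (transition p q) y := (contDiffOn_transition p q).contDiffAt hopen
  have hd : ContDiffAt ℝ ∞ (density g q) (transition p q y) :=
    (contDiffOn_density g q).contDiffAt ((φ[q]).open_target.mem_nhds (transition_mem p q hy).1)
  have hc : ContDiffAt ℝ ∞ (coordField X p) y :=
    (contDiffOn_coordField X p).contDiffAt ((φ[p]).open_target.mem_nhds hy.1)
  rw [← euclDiv_piola (Y := fun x => density g q (transition p q x) • coordField X p x)
    (hψ.of_le (by norm_cast)) (fderiv_transition_comp p q hy)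
    (((hd.comp y hψ).smul hc).differentiableAt (by simp))
    ((contDiffAt_weightedField g X q (transition_mem p q hy).1).differentiableAt (by simp))]
  · have h1 : weightedField g X p =ᶠ[𝓝 y] fun x => |(fderiv ℝ (transition p q) x).det| •
        density g q (transition p q x) • coordField X p x := by
      filter_upwards [hopen] with x hx
      rw [weightedField, density_transition g p q hx, mul_smul]
    refine Finset.sum_congr rfl fun i _ => ?_
    rw [Filter.EventuallyEq.fderiv_eq]
    filter_upwards [h1] with x hx
    rw [hx]
  · filter_upwards [hopen] with x hx
    rw [map_smul, weightedField, coordField_transition X p q hx]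

/-- The divergence can be computed in any chart. -/
lemma divergence_chart (g : Metric d M) (X : VField d M) (p : M) {y : Model d}
    (hy : y ∈ (φ[p]).target) :
    divergence g X ((φ[p]).symm y) = (density g p y)⁻¹ * euclDiv (weightedField g X p) y := by
  set q := (φ[p]).symm y with hq
  have hy' : y ∈ overlap p q := ⟨hy, mem_chart_source (Model d) q⟩
  have h1 : transition p q y = φ[q] q := rfl
  rw [divergence_eq, euclDiv_weightedField_transition g X p q hy', density_transition g p q hy', h1,
    mul_inv]
  have := abs_pos.2 (det_fderiv_transition_ne_zero p q hy')
  field_simp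

lemma density_mul_divergence (g : Metric d M) (X : VField d M) (p : M) {y : Model d}
    (hy : y ∈ (φ[p]).target) :
    density g p y * divergence g X ((φ[p]).symm y) = euclDiv (weightedField g X p) y := by
  rw [divergence_chart g X p hy, mul_inv_cancel_left₀ (density_pos g p hy).ne']

lemma continuousOn_euclDiv {W : Model d → Model d} {s : Set (Model d)} (hs : IsOpen s)
    (hW : ContDiffOn ℝ ∞ W s) : ContinuousOn (euclDiv W) s := by
  refine continuousOn_finsetSum _ fun i _ => ?_
  have h1 : ContDiffOn ℝ ∞ (fun z => W z i) s :=
    (EuclideanSpace.proj i : Model d →L[ℝ] ℝ).contDiff.comp_contDiffOn hW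
  exact (h1.continuousOn_fderiv_of_isOpen hs (by simp)).clm_apply continuousOn_const

lemma continuous_divergence (g : Metric d M) (X : VField d M) : Continuous (divergence g X) := by
  rw [continuous_iff_continuousAt]
  intro p
  have hp := mem_chart_source (Model d) p
  have h1 : ContinuousOn (fun y => (density g p y)⁻¹ * euclDiv (weightedField g X p) y)
      (φ[p]).target :=
    ((contDiffOn_density g p).continuousOn.inv₀ fun y hy => (density_pos g p hy).ne').mul
      (continuousOn_euclDiv (φ[p]).open_target (contDiffOn_weightedField g X p))
  have h2 := h1.comp (φ[p]).continuousOn (φ[p]).mapsTo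
  refine (h2.continuousAt ((φ[p]).open_source.mem_nhds hp)).congr ?_
  filter_upwards [(φ[p]).open_source.mem_nhds hp] with q hq
  simp only [Function.comp]
  rw [← divergence_chart g X p ((φ[p]).map_source hq), (φ[p]).left_inv hq]

end DivergenceChart

/-! ### The Riemannian volume in a chart -/

section Volume

variable {d : ℕ} {M : Type*} [TopologicalSpace M] [ChartedSpace (Model d) M]
  [IsManifold (𝓡 d) ∞ M] [MeasurableSpace M] [BorelSpace M]

local notation "φ[" p "]" => chartAt (Model d) p

lemma measurableSet_chart_preimage (p : M) {A : Set M} (hA : MeasurableSet A) :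
    MeasurableSet ((φ[p]).target ∩ (φ[p]).symm ⁻¹' A) := by
  have h1 : Measurable ((φ[p]).target.domRestrict (φ[p]).symm) :=
    (continuousOn_iff_continuous_domRestrict.1 (φ[p]).continuousOn_symm).measurable
  convert MeasurableSet.subtype_image (φ[p]).open_target.measurableSet (h1 hA) using 1
  ext y
  constructor
  · rintro ⟨h1, h2⟩
    exact ⟨⟨y, h1⟩, h2, rfl⟩
  · rintro ⟨⟨z, hz⟩, h2, rfl⟩
    exact ⟨hz, h2⟩

lemma aemeasurable_chart_symm (p : M) :
    AEMeasurable (φ[p]).symm (volume.restrict (φ[p]).target) :=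
  (φ[p]).continuousOn_symm.aemeasurable (φ[p]).open_target.measurableSet

lemma aemeasurable_density (g : Metric d M) (p : M) :
    AEMeasurable (density g p) (volume.restrict (φ[p]).target) :=
  (contDiffOn_density g p).continuousOn.aemeasurable (φ[p]).open_target.measurableSet

lemma chartVolume_apply (g : Metric d M) (p : M) {A : Set M} (hA : MeasurableSet A) :
    chartVolume g p A =
      ∫⁻ y in (φ[p]).target ∩ (φ[p]).symm ⁻¹' A, ENNReal.ofReal (density g p y) := by
  rw [chartVolume, Measure.map_apply_of_aemeasurable
    ((aemeasurable_chart_symm p).mono_ac (withDensity_absolutelyContinuous _ _)) hA]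
  have h1 := (aemeasurable_chart_symm (d := d) p).nullMeasurableSet_preimage hA
  rw [withDensity_apply₀ _ h1, Measure.restrict_restrict₀ h1, inter_comm]

/-- On the overlap of two charts, either measure is at most the other one, by the change of variables formula and the
transformation law of the density. -/
lemma chartVolume_restrict_le (g : Metric d M) (p q : M) :
    (chartVolume g q).restrict (φ[p]).source ≤ chartVolume g p := by
  refine Measure.le_iff.2 fun A hA => ?_
  have hs := (φ[p]).open_source.measurableSet
  rw [Measure.restrict_apply hA, chartVolume_apply g q (hA.inter hs), chartVolume_apply g p hA]
  set s : Set (Model d) := (φ[p]).target ∩ (φ[p]).symm ⁻¹' (A ∩ (φ[q]).source) with hsdef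
  have hsm : MeasurableSet s :=
    measurableSet_chart_preimage p (hA.inter (φ[q]).open_source.measurableSet)
  have hsub : s ⊆ overlap p q := fun y hy => ⟨hy.1, hy.2.2⟩
  have himg : (φ[q]).target ∩ (φ[q]).symm ⁻¹' (A ∩ (φ[p]).source) = transition p q '' s := by
    ext z
    constructor
    · rintro ⟨h1, h2, h3⟩
      have hz : z ∈ overlap q p := ⟨h1, h3⟩
      refine ⟨transition q p z, ⟨(transition_mem q p hz).1, ?_, (transition_mem q p hz).2⟩,
        transition_transition q p hz⟩
      rw [symm_transition q p hz]; exact h2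
    · rintro ⟨y, hy, rfl⟩
      have h := transition_mem p q (hsub hy)
      refine ⟨h.1, ?_, h.2⟩
      rw [symm_transition p q (hsub hy)]; exact hy.2.1
  have hinj : InjOn (transition p q) s := by
    intro x hx y hy hxy
    rw [← transition_transition p q (hsub hx), hxy, transition_transition p q (hsub hy)]
  rw [himg, lintegral_image_eq_lintegral_abs_det_fderiv_mul volume hsm
    (fun y hy => ((hasFDerivAt_transition p q (hsub hy)).hasFDerivWithinAt)) hinj]
  calc _ = ∫⁻ y in s, ENNReal.ofReal (density g p y) := by
        refine setLIntegral_congr_fun hsm fun y hy => ?_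
        simp only
        rw [density_transition g p q (hsub hy), ENNReal.ofReal_mul (abs_nonneg _),
          fderiv_transition p q (hsub hy)]
    _ ≤ _ := lintegral_mono_set (inter_subset_inter_right _ (preimage_mono inter_subset_left))

lemma chartVolume_compl (g : Metric d M) (p : M) : chartVolume g p (φ[p]).sourceᶜ = 0 := by
  rw [chartVolume_apply g p (φ[p]).open_source.measurableSet.compl]
  have : (φ[p]).target ∩ (φ[p]).symm ⁻¹' (φ[p]).sourceᶜ = ∅ := by
    ext y
    simp only [mem_inter_iff, mem_preimage, mem_compl_iff, mem_empty_iff_false, iff_false, not_and,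
      not_not]
    exact fun hy => (φ[p]).map_target hy
  rw [this, Measure.restrict_empty, lintegral_zero_measure]

/-- The Riemannian volume is `√det g dy` in every chart. -/
lemma vol_restrict_source (g : Metric d M) (p : M) :
    (vol g).restrict (φ[p]).source = chartVolume g p := by
  have hs := (φ[p]).open_source.measurableSet
  refine le_antisymm ?_ ?_
  · have h : vol g ≤ chartVolume g p + (vol g).restrict (φ[p]).sourceᶜ := by
      refine iSup_le fun q => ?_
      rw [← Measure.restrict_add_restrict_compl (μ := chartVolume g q) hs]
      exact add_le_add (chartVolume_restrict_le g p q)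
        (Measure.restrict_mono le_rfl (le_iSup (chartVolume g) q))
    refine (Measure.restrict_mono le_rfl h).trans ?_
    rw [Measure.restrict_add, Measure.restrict_restrict hs, inter_compl_self,
      Measure.restrict_empty, add_zero]
    exact Measure.restrict_le_self
  · calc chartVolume g p = (chartVolume g p).restrict (φ[p]).source :=
          (Measure.restrict_eq_self_of_ae_mem (by
            rw [ae_iff]; exact chartVolume_compl g p)).symm
      _ ≤ _ := Measure.restrict_mono le_rfl (le_iSup (chartVolume g) p)

lemma vol_apply (g : Metric d M) (p : M) {A : Set M} (hA : MeasurableSet A)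
    (hAs : A ⊆ (φ[p]).source) :
    vol g A = ∫⁻ y in (φ[p]).target ∩ (φ[p]).symm ⁻¹' A, ENNReal.ofReal (density g p y) := by
  rw [← chartVolume_apply g p hA, ← vol_restrict_source g p, Measure.restrict_apply hA,
    inter_eq_left.2 hAs]

lemma setIntegral_vol (g : Metric d M) (p : M) {A : Set M} (hA : MeasurableSet A)
    (hAs : A ⊆ (φ[p]).source) {f : M → ℝ} (hf : StronglyMeasurable f) :
    ∫ q in A, f q ∂(vol g) =
      ∫ y in (φ[p]).target ∩ (φ[p]).symm ⁻¹' A, density g p y * f ((φ[p]).symm y) := by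
  have hs := (φ[p]).open_source.measurableSet
  have ht := (φ[p]).open_target.measurableSet
  set S : Set (Model d) := (φ[p]).target ∩ (φ[p]).symm ⁻¹' A with hS
  have hSm : MeasurableSet S := measurableSet_chart_preimage p hA
  have h1 : ∫ q in A, f q ∂(vol g) = ∫ q, A.indicator f q ∂(chartVolume g p) := by
    rw [← vol_restrict_source g p, setIntegral_indicator hA, inter_eq_right.2 hAs]
  rw [h1, chartVolume, integral_map
    ((aemeasurable_chart_symm p).mono_ac (withDensity_absolutelyContinuous _ _))
    (hf.indicator hA).aestronglyMeasurable,
    integral_withDensity_eq_integral_toReal_smul₀ (aemeasurable_density g p).ennreal_ofReal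
      (ae_of_all _ fun _ => ENNReal.ofReal_lt_top)]
  have h2 : ∀ y ∈ (φ[p]).target, (ENNReal.ofReal (density g p y)).toReal •
      A.indicator f ((φ[p]).symm y) =
      S.indicator (fun y => density g p y * f ((φ[p]).symm y)) y := by
    intro y hy
    rw [ENNReal.toReal_ofReal (density_pos g p hy).le, smul_eq_mul]
    by_cases h : (φ[p]).symm y ∈ A
    · rw [indicator_of_mem h, indicator_of_mem (show y ∈ S from ⟨hy, h⟩)]
    · rw [indicator_of_notMem h, indicator_of_notMem (fun h' : y ∈ S => h h'.2), mul_zero]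
  rw [setIntegral_congr_fun ht h2, setIntegral_indicator hSm, hS, ← inter_assoc, inter_self]

end Volume

/-! ### Extension by zero from a chart -/

section Extension

variable {d : ℕ} {M : Type*} [TopologicalSpace M] [ChartedSpace (Model d) M]
  [IsManifold (𝓡 d) ∞ M]

local notation "φ[" p "]" => chartAt (Model d) p

lemma isCompact_chart_symm_image (p : M) {K : Set (Model d)} (hK : IsCompact K)
    (hKt : K ⊆ (φ[p]).target) : IsCompact ((φ[p]).symm '' K) :=
  hK.image_of_continuousOn ((φ[p]).continuousOn_symm.mono hKt)

/-- A smooth field with compact support in the target of a chart is the coordinate expression of a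
smooth field on `M` that vanishes outside the chart. -/
lemma exists_vfield_of_coord [T2Space M] (p : M) {F : Model d → Model d} (hF : ContDiff ℝ ∞ F)
    {K : Set (Model d)} (hK : IsCompact K) (hKt : K ⊆ (φ[p]).target) (h0 : ∀ y ∉ K, F y = 0) :
    ∃ X : VField d M, (∀ y ∈ (φ[p]).target, coordField X p y = F y) ∧
      (∀ q ∈ (φ[p]).source, X q = pushMap p (φ[p] q) (F (φ[p] q))) ∧
      ∀ q ∉ (φ[p]).symm '' K, X q = 0 := by
  classical
  set V : ∀ q : M, TangentSpace (𝓡 d) q := fun q =>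
    if q ∈ (φ[p]).source then pushMap p (φ[p] q) (F (φ[p] q)) else (0 : Model d) with hV
  have hVs : ∀ q ∈ (φ[p]).source, V q = pushMap p (φ[p] q) (F (φ[p] q)) := fun q hq => if_pos hq
  have hV0 : ∀ q ∉ (φ[p]).symm '' K, V q = 0 := by
    intro q hq
    by_cases hs : q ∈ (φ[p]).source
    · have : F (φ[p] q) = 0 := h0 _ fun h => hq ⟨_, h, (φ[p]).left_inv hs⟩
      refine (hVs q hs).trans ?_
      rw [this]
      exact map_zero (pushMap p (φ[p] q))
    · exact if_neg hs
  have hsm : ContMDiff (𝓡 d) ((𝓡 d).prod 𝓘(ℝ, Model d)) ∞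
      (fun q => (⟨q, V q⟩ : TangentBundle (𝓡 d) M)) := by
    intro q
    by_cases hs : q ∈ (φ[p]).source
    · have h1 : ContMDiffOn (𝓡 d) 𝓘(ℝ, Model d) ∞ φ[p] (φ[p]).source :=
        contMDiffOn_chart (I := 𝓡 d) (n := ∞) (x := p)
      have h2 := (contMDiffOn_push p hF.contDiffOn Subset.rfl).comp h1 (φ[p]).mapsTo
      refine (h2.contMDiffAt ((φ[p]).open_source.mem_nhds hs)).congr_of_eventuallyEq ?_
      filter_upwards [(φ[p]).open_source.mem_nhds hs] with z hz
      simp only [Function.comp]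
      rw [(φ[p]).left_inv hz, hVs z hz]
    · have h2 : q ∉ (φ[p]).symm '' K := by
        rintro ⟨y, hy, rfl⟩
        exact hs ((φ[p]).map_target (hKt hy))
      have h3 := (isCompact_chart_symm_image p hK hKt).isClosed.isOpen_compl.mem_nhds h2
      refine (Bundle.contMDiff_zeroSection ℝ (fun x : M => TangentSpace (𝓡 d) x)
        q).congr_of_eventuallyEq ?_
      filter_upwards [h3] with z hz
      rw [hV0 z hz]
      rfl
  refine ⟨⟨V, hsm⟩, fun y hy => ?_, hVs, hV0⟩
  have h1 := hVs _ ((φ[p]).map_target hy)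
  rw [(φ[p]).right_inv hy] at h1
  refine Eq.trans ?_ (pullMap_pushMap p hy (F y))
  exact congrArg (pullMap p ((φ[p]).symm y)) h1

/-- A smooth function with compact support in the target of a chart extends by zero to `M`. -/
lemma exists_contMDiff_of_coord [T2Space M] (p : M) {f : Model d → ℝ} (hf : ContDiff ℝ ∞ f)
    {K : Set (Model d)} (hK : IsCompact K) (hKt : K ⊆ (φ[p]).target) (h0 : ∀ y ∉ K, f y = 0) :
    ∃ u : M → ℝ, ContMDiff (𝓡 d) 𝓘(ℝ) ∞ u ∧ (∀ q ∈ (φ[p]).source, u q = f (φ[p] q)) ∧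
      ∀ q ∉ (φ[p]).symm '' K, u q = 0 := by
  classical
  set u : M → ℝ := fun q => if q ∈ (φ[p]).source then f (φ[p] q) else 0 with hu
  have hu0 : ∀ q ∉ (φ[p]).symm '' K, u q = 0 := by
    intro q hq
    by_cases hs : q ∈ (φ[p]).source
    · simp only [hu, if_pos hs]
      exact h0 _ fun h => hq ⟨_, h, (φ[p]).left_inv hs⟩
    · simp only [hu, if_neg hs]
  have hus : ∀ q ∈ (φ[p]).source, u q = f (φ[p] q) := fun q hq => if_pos hq
  refine ⟨u, fun q => ?_, hus, hu0⟩
  by_cases hs : q ∈ (φ[p]).source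
  · have h1 : ContMDiffOn (𝓡 d) 𝓘(ℝ, Model d) ∞ φ[p] (φ[p]).source :=
      contMDiffOn_chart (I := 𝓡 d) (n := ∞) (x := p)
    refine ((hf.contMDiff.comp_contMDiffOn h1).contMDiffAt
      ((φ[p]).open_source.mem_nhds hs)).congr_of_eventuallyEq ?_
    filter_upwards [(φ[p]).open_source.mem_nhds hs] with z hz
    exact hus z hz
  · have h2 : q ∉ (φ[p]).symm '' K := by
      rintro ⟨y, hy, rfl⟩
      exact hs ((φ[p]).map_target (hKt hy))
    have h3 := (isCompact_chart_symm_image p hK hKt).isClosed.isOpen_compl.mem_nhds h2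
    refine (contMDiffAt_const (c := (0:ℝ))).congr_of_eventuallyEq ?_
    filter_upwards [h3] with z hz
    exact hu0 z hz

end Extension

/-! ### The product rule for the divergence -/

section ProductRule

variable {d : ℕ} {M : Type*} [TopologicalSpace M] [ChartedSpace (Model d) M]
  [IsManifold (𝓡 d) ∞ M]

local notation "φ[" p "]" => chartAt (Model d) p

/-- The product of a smooth function and a smooth field. -/
noncomputable def mulField (u : M → ℝ) (hu : ContMDiff (𝓡 d) 𝓘(ℝ) ∞ u) (X : VField d M) :
    VField d M :=
  ⟨fun q => u q • X q, hu.smul_section X.contMDiff⟩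

lemma mulField_apply (u : M → ℝ) (hu : ContMDiff (𝓡 d) 𝓘(ℝ) ∞ u) (X : VField d M) (q : M) :
    mulField u hu X q = u q • X q := rfl

lemma coordField_mulField (u : M → ℝ) (hu : ContMDiff (𝓡 d) 𝓘(ℝ) ∞ u) (X : VField d M) (p : M)
    (y : Model d) : coordField (mulField u hu X) p y = u ((φ[p]).symm y) • coordField X p y :=
  map_smul (pullMap p ((φ[p]).symm y)) _ (X ((φ[p]).symm y) : Model d)

lemma euclDiv_smul {f : Model d → ℝ} {W : Model d → Model d} {y : Model d}
    (hf : DifferentiableAt ℝ f y) (hW : DifferentiableAt ℝ W y) :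
    euclDiv (fun x => f x • W x) y = f y * euclDiv W y + fderiv ℝ f y (W y) := by
  have h1 : ∀ i : Fin d, DifferentiableAt ℝ (fun z => W z i) y := fun i =>
    (EuclideanSpace.proj i : Model d →L[ℝ] ℝ).differentiableAt.comp y hW
  simp only [euclDiv, PiLp.smul_apply, smul_eq_mul]
  conv_rhs => rw [eq_sum_single (W y), map_sum, Finset.mul_sum, ← Finset.sum_add_distrib]
  refine Finset.sum_congr rfl fun i _ => ?_
  have h2 := (hf.hasFDerivAt.mul (h1 i).hasFDerivAt).fderiv
  refine (congrArg (fun L : Model d →L[ℝ] ℝ => L (EuclideanSpace.single i 1)) h2).trans ?_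
  simp

lemma contDiffOn_comp_symm {u : M → ℝ} (hu : ContMDiff (𝓡 d) 𝓘(ℝ) ∞ u) (p : M) :
    ContDiffOn ℝ ∞ (fun y => u ((φ[p]).symm y)) (φ[p]).target := by
  have h0 : ContMDiffOn 𝓘(ℝ, Model d) (𝓡 d) ∞ (φ[p]).symm (φ[p]).target :=
    contMDiffOn_chart_symm (I := 𝓡 d) (n := ∞) (x := p)
  exact contMDiffOn_iff_contDiffOn.1 (hu.comp_contMDiffOn h0)

/-- The product rule, in the chart at `p`. -/
lemma divergence_mulField (g : Metric d M) {u : M → ℝ} (hu : ContMDiff (𝓡 d) 𝓘(ℝ) ∞ u)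
    (X : VField d M) (p : M) {y : Model d} (hy : y ∈ (φ[p]).target) :
    divergence g (mulField u hu X) ((φ[p]).symm y) =
      u ((φ[p]).symm y) * divergence g X ((φ[p]).symm y) +
        fderiv ℝ (fun z => u ((φ[p]).symm z)) y (coordField X p y) := by
  have h1 : weightedField g (mulField u hu X) p =
      fun z => u ((φ[p]).symm z) • weightedField g X p z := by
    ext1 z
    rw [weightedField, coordField_mulField, smul_comm, weightedField]
  have h2 : DifferentiableAt ℝ (fun z => u ((φ[p]).symm z)) y :=
    ((contDiffOn_comp_symm hu p).contDiffAt
      ((φ[p]).open_target.mem_nhds hy)).differentiableAt (by simp)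
  rw [divergence_chart g _ p hy, h1, euclDiv_smul h2
    ((contDiffAt_weightedField g X p hy).differentiableAt (by simp)), divergence_chart g X p hy,
    weightedField, map_smul, smul_eq_mul]
  have := (density_pos g p hy).ne'
  field_simp

/-- The derivative of `u` along `X`. -/
noncomputable def dirDeriv (u : M → ℝ) (X : VField d M) (q : M) : ℝ :=
  fderiv ℝ (fun z => u ((φ[q]).symm z)) (φ[q] q) (coordField X q (φ[q] q))

lemma divergence_mulField_eq (g : Metric d M) {u : M → ℝ} (hu : ContMDiff (𝓡 d) 𝓘(ℝ) ∞ u)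
    (X : VField d M) (q : M) :
    divergence g (mulField u hu X) q = u q * divergence g X q + dirDeriv u X q := by
  have h := divergence_mulField g hu X q (mem_chart_target (Model d) q)
  rwa [(φ[q]).left_inv (mem_chart_source (Model d) q)] at h

lemma dirDeriv_chart (g : Metric d M) {u : M → ℝ} (hu : ContMDiff (𝓡 d) 𝓘(ℝ) ∞ u)
    (X : VField d M) (p : M) {y : Model d} (hy : y ∈ (φ[p]).target) :
    dirDeriv u X ((φ[p]).symm y) =
      fderiv ℝ (fun z => u ((φ[p]).symm z)) y (coordField X p y) := by
  have h1 := divergence_mulField g hu X p hy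
  rw [divergence_mulField_eq] at h1
  linarith

lemma dirDeriv_one_sub (u : M → ℝ) (X : VField d M) (q : M) :
    dirDeriv (fun z => 1 - u z) X q = - dirDeriv u X q := by
  simp [dirDeriv, fderiv_const_sub]

lemma continuous_dirDeriv (g : Metric d M) {u : M → ℝ} (hu : ContMDiff (𝓡 d) 𝓘(ℝ) ∞ u)
    (X : VField d M) : Continuous (dirDeriv u X) := by
  have h : dirDeriv u X = fun q => divergence g (mulField u hu X) q - u q * divergence g X q := by
    ext q; rw [divergence_mulField_eq]; ring
  rw [h]
  exact (continuous_divergence g _).sub (hu.continuous.mul (continuous_divergence g X))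

lemma divergence_eq_zero (g : Metric d M) {X : VField d M} {q : M} (h : ∀ᶠ z in 𝓝 q, X z = 0) :
    divergence g X q = 0 := by
  have h1 : weightedField g X q =ᶠ[𝓝 (φ[q] q)] fun _ => 0 := by
    have hc : Tendsto (φ[q]).symm (𝓝 (φ[q] q)) (𝓝 q) := by
      have := (φ[q]).continuousAt_symm (mem_chart_target (Model d) q)
      rwa [ContinuousAt, (φ[q]).left_inv (mem_chart_source (Model d) q)] at this
    filter_upwards [hc.eventually h] with y hy
    have : coordField X q y = 0 := by
      refine Eq.trans (congrArg (pullMap q ((φ[q]).symm y)) hy) ?_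
      exact map_zero _
    rw [weightedField, this, smul_zero]
  rw [divergence_eq]
  have h2 : euclDiv (weightedField g X q) (φ[q] q) = 0 := by
    refine Finset.sum_eq_zero fun i _ => ?_
    have h3 : (fun z => weightedField g X q z i) =ᶠ[𝓝 (φ[q] q)] fun _ => 0 := by
      filter_upwards [h1] with y hy
      rw [hy]; rfl
    rw [h3.fderiv_eq]
    simp
  rw [h2, mul_zero]

lemma dirDeriv_eq_zero {u : M → ℝ} {X : VField d M} {q : M} (h : ∀ᶠ z in 𝓝 q, u z = 0) :
    dirDeriv u X q = 0 := by
  have hc : Tendsto (φ[q]).symm (𝓝 (φ[q] q)) (𝓝 q) := by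
    have := (φ[q]).continuousAt_symm (mem_chart_target (Model d) q)
    rwa [ContinuousAt, (φ[q]).left_inv (mem_chart_source (Model d) q)] at this
  have h3 : (fun z => u ((φ[q]).symm z)) =ᶠ[𝓝 (φ[q] q)] fun _ => 0 := hc.eventually h
  rw [dirDeriv, h3.fderiv_eq]
  simp

end ProductRule

/-! ### The divergence theorem in a chart -/

section DivergenceTheorem

variable {d : ℕ}

lemma integral_euclDiv_eq_zero {W : Model d → Model d} (hW : ContDiff ℝ ∞ W)
    (hc : HasCompactSupport W) : ∫ y, euclDiv W y = 0 := by
  have h1 : ∀ i : Fin d, ContDiff ℝ ∞ (fun z => W z i) := fun i =>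
    (EuclideanSpace.proj i : Model d →L[ℝ] ℝ).contDiff.comp hW
  have hc1 : ∀ i : Fin d, HasCompactSupport (fun z => W z i) := fun i =>
    hc.comp_left (g := fun v : Model d => v i) rfl
  have hint : ∀ i : Fin d, Integrable
      (fun y => fderiv ℝ (fun z => W z i) y (EuclideanSpace.single i (1:ℝ))) := fun i =>
    (((h1 i).continuous_fderiv (by simp)).clm_apply continuous_const).integrable_of_hasCompactSupport
      ((hc1 i).fderiv_apply ℝ _)
  simp only [euclDiv]
  rw [integral_finsetSum _ fun i _ => hint i]
  refine Finset.sum_eq_zero fun i _ => ?_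
  have h := integral_mul_fderiv_eq_neg_fderiv_mul_of_integrable (μ := (volume : Measure (Model d)))
    (f := fun _ => (1:ℝ)) (g := fun z => W z i) (v := EuclideanSpace.single i (1:ℝ))
    (by simp) (by simpa using hint i)
    (by simpa using (h1 i).continuous.integrable_of_hasCompactSupport (hc1 i))
    (fun _ _ => differentiableAt_const _) (fun y _ => (h1 i).differentiable (by simp) y)
  simpa using h

end DivergenceTheorem

section DivergenceTheoremManifold

variable {d : ℕ} {M : Type*} [TopologicalSpace M] [ChartedSpace (Model d) M]
  [IsManifold (𝓡 d) ∞ M] [MeasurableSpace M] [BorelSpace M] [T2Space M]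

local notation "φ[" p "]" => chartAt (Model d) p

/-- The divergence theorem for fields with compact support in a chart. -/
lemma integral_divergence_eq_zero (g : Metric d M) (X : VField d M) (p : M)
    {K : Set (Model d)} (hK : IsCompact K) (hKt : K ⊆ (φ[p]).target)
    (h0 : ∀ q ∉ (φ[p]).symm '' K, X q = 0) : ∫ q, divergence g X q ∂(vol g) = 0 := by
  have hs := (φ[p]).open_source.measurableSet
  have hcl := (isCompact_chart_symm_image p hK hKt).isClosed
  have h1 : ∫ q, divergence g X q ∂(vol g) = ∫ q in (φ[p]).source, divergence g X q ∂(vol g) := by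
    refine (setIntegral_eq_integral_of_forall_compl_eq_zero fun q hq => ?_).symm
    have hq' : q ∉ (φ[p]).symm '' K := by
      rintro ⟨y, hy, rfl⟩
      exact hq ((φ[p]).map_target (hKt hy))
    refine divergence_eq_zero g ?_
    filter_upwards [hcl.isOpen_compl.mem_nhds hq'] with z hz using h0 z hz
  have h2 : (φ[p]).target ∩ (φ[p]).symm ⁻¹' (φ[p]).source = (φ[p]).target :=
    inter_eq_left.2 fun y hy => (φ[p]).map_target hy
  rw [h1, setIntegral_vol g p hs Subset.rfl (continuous_divergence g X).stronglyMeasurable, h2]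
  have ht := (φ[p]).open_target.measurableSet
  rw [setIntegral_congr_fun ht fun y hy => density_mul_divergence g X p hy]
  set W := (φ[p]).target.indicator (weightedField g X p) with hWdef
  have hW0 : ∀ y ∉ K, W y = 0 := by
    intro y hy
    by_cases hyt : y ∈ (φ[p]).target
    · have hq' : (φ[p]).symm y ∉ (φ[p]).symm '' K := by
        rintro ⟨z, hz, hzy⟩
        rw [(φ[p]).symm.injOn (hKt hz) hyt hzy] at hz
        exact hy hz
      have : coordField X p y = 0 := by
        refine Eq.trans (congrArg (pullMap p ((φ[p]).symm y)) (h0 _ hq')) ?_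
        exact map_zero _
      rw [hWdef, indicator_of_mem hyt, weightedField, this, smul_zero]
    · rw [hWdef, indicator_of_notMem hyt]
  have hWeq : ∀ y ∈ (φ[p]).target, W =ᶠ[𝓝 y] weightedField g X p := by
    intro y hy
    filter_upwards [(φ[p]).open_target.mem_nhds hy] with z hz
    rw [hWdef, indicator_of_mem hz]
  have hW0' : ∀ y ∉ K, W =ᶠ[𝓝 y] fun _ => 0 := by
    intro y hy
    filter_upwards [hK.isClosed.isOpen_compl.mem_nhds hy] with z hz using hW0 z hz
  have hWs : ContDiff ℝ ∞ W := by
    rw [contDiff_iff_contDiffAt]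
    intro y
    by_cases hyt : y ∈ (φ[p]).target
    · exact (contDiffAt_weightedField g X p hyt).congr_of_eventuallyEq (hWeq y hyt)
    · exact contDiffAt_const.congr_of_eventuallyEq (hW0' y fun h => hyt (hKt h))
  rw [← integral_euclDiv_eq_zero hWs (HasCompactSupport.intro hK hW0)]
  have h3 : ∀ y ∈ (φ[p]).target, euclDiv (weightedField g X p) y = euclDiv W y := by
    intro y hy
    refine Finset.sum_congr rfl fun i _ => ?_
    rw [Filter.EventuallyEq.fderiv_eq]
    filter_upwards [hWeq y hy] with z hz
    rw [hz]
  rw [setIntegral_congr_fun ht h3]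
  refine setIntegral_eq_integral_of_forall_compl_eq_zero fun y hy => ?_
  refine Finset.sum_eq_zero fun i _ => ?_
  have h4 : (fun z => W z i) =ᶠ[𝓝 y] fun _ => 0 := by
    filter_upwards [hW0' y fun h => hy (hKt h)] with z hz
    rw [hz]; rfl
  rw [h4.fderiv_eq]
  simp

end DivergenceTheoremManifold

/-! ### Cubes in the model space -/

section Cubes

variable {d : ℕ}

/-- The open cube with centre `c` and half-side `r`, i.e. the ball of the supremum distance. -/
def cube (c : Model d) (r : ℝ) : Set (Model d) := WithLp.ofLp ⁻¹' Metric.ball c.ofLp r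

/-- The closed cube with centre `c` and half-side `r`. -/
def closedCube (c : Model d) (r : ℝ) : Set (Model d) := WithLp.ofLp ⁻¹' Metric.closedBall c.ofLp r

lemma mem_closedCube {c y : Model d} {r : ℝ} (hr : 0 ≤ r) :
    y ∈ closedCube c r ↔ ∀ i, |y i - c i| ≤ r := by
  rw [closedCube, mem_preimage, Metric.mem_closedBall, dist_pi_le_iff hr]
  rfl

lemma mem_cube {c y : Model d} {r : ℝ} (hr : 0 < r) :
    y ∈ cube c r ↔ ∀ i, |y i - c i| < r := by
  rw [cube, mem_preimage, Metric.mem_ball, dist_pi_lt_iff hr]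
  rfl

lemma isOpen_cube (c : Model d) (r : ℝ) : IsOpen (cube c r) :=
  Metric.isOpen_ball.preimage (PiLp.continuous_ofLp 2 _)

lemma isClosed_closedCube (c : Model d) (r : ℝ) : IsClosed (closedCube c r) :=
  Metric.isClosed_closedBall.preimage (PiLp.continuous_ofLp 2 _)

lemma isCompact_closedCube (c : Model d) (r : ℝ) : IsCompact (closedCube c r) := by
  have h := (isCompact_closedBall c.ofLp r).image (PiLp.continuous_toLp 2 (fun _ : Fin d => ℝ))
  convert h using 1
  ext y
  constructor
  · exact fun hy => ⟨y.ofLp, hy, rfl⟩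
  · rintro ⟨z, hz, rfl⟩
    exact hz

lemma cube_subset_closedCube (c : Model d) (r : ℝ) : cube c r ⊆ closedCube c r :=
  preimage_mono Metric.ball_subset_closedBall

lemma closedCube_subset_closedCube (c : Model d) {r s : ℝ} (h : r ≤ s) :
    closedCube c r ⊆ closedCube c s :=
  preimage_mono (Metric.closedBall_subset_closedBall h)

lemma cube_subset_cube (c : Model d) {r s : ℝ} (h : r ≤ s) : cube c r ⊆ cube c s :=
  preimage_mono (Metric.ball_subset_ball h)

lemma center_mem_cube (c : Model d) {r : ℝ} (hr : 0 < r) : c ∈ cube c r := Metric.mem_ball_self hr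

lemma volume_cube (c : Model d) {r : ℝ} (hr : 0 < r) :
    volume (cube c r) = ENNReal.ofReal ((2 * r) ^ d) := by
  have h := (EuclideanSpace.volume_preserving_symm_measurableEquiv_toLp (Fin d)).measure_preimage
    (Metric.isOpen_ball (x := c.ofLp) (ε := r)).measurableSet.nullMeasurableSet
  rw [Real.volume_pi_ball _ hr, Fintype.card_fin] at h
  exact h

lemma exists_closedCube_subset {c : Model d} {s : Set (Model d)} (hs : s ∈ 𝓝 c) :
    ∃ r > 0, closedCube c r ⊆ s := by
  have h1 : WithLp.toLp 2 ⁻¹' s ∈ 𝓝 c.ofLp :=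
    (PiLp.continuous_toLp 2 (fun _ : Fin d => ℝ)).continuousAt.preimage_mem_nhds hs
  obtain ⟨r, hr, h⟩ := Metric.nhds_basis_closedBall.mem_iff.1 h1
  exact ⟨r, hr, fun y hy => h hy⟩

end Cubes

/-! ### Coordinate cubes -/

section ChartCubes

variable {d : ℕ} {M : Type*} [TopologicalSpace M] [ChartedSpace (Model d) M]

local notation "φ[" p "]" => chartAt (Model d) p

/-- A radius such that the closed cube of twice this radius around `p` lies in the chart at `p`. -/
noncomputable def cubeRadius (d : ℕ) {M : Type*} [TopologicalSpace M] [ChartedSpace (Model d) M]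
    (p : M) : ℝ :=
  (exists_closedCube_subset (chart_target_mem_nhds (Model d) p)).choose / 2

lemma cubeRadius_pos (p : M) : 0 < cubeRadius d p :=
  half_pos (exists_closedCube_subset (chart_target_mem_nhds (Model d) p)).choose_spec.1

lemma closedCube_subset_target (p : M) {t : ℝ} (ht : t ≤ 2 * cubeRadius d p) :
    closedCube (φ[p] p) t ⊆ (φ[p]).target := by
  refine Subset.trans (closedCube_subset_closedCube _ ?_)
    (exists_closedCube_subset (chart_target_mem_nhds (Model d) p)).choose_spec.2
  refine ht.trans (le_of_eq ?_)
  rw [cubeRadius]; ring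

/-- The open cube of half-side `t` around `p` in the chart at `p`, as a subset of `M`. -/
def chartCube (d : ℕ) {M : Type*} [TopologicalSpace M] [ChartedSpace (Model d) M] (p : M) (t : ℝ) :
    Set M :=
  (chartAt (Model d) p).source ∩ chartAt (Model d) p ⁻¹' cube (chartAt (Model d) p p) t

lemma isOpen_chartCube (p : M) (t : ℝ) : IsOpen (chartCube d p t) :=
  (φ[p]).isOpen_inter_preimage (isOpen_cube _ _)

lemma mem_chartCube (p : M) {t : ℝ} (ht : 0 < t) : p ∈ chartCube d p t :=
  ⟨mem_chart_source _ p, center_mem_cube _ ht⟩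

lemma chartCube_eq_empty (p : M) {s : ℝ} (hs : s ≤ 0) : chartCube d p s = ∅ := by
  rw [chartCube, cube, Metric.ball_eq_empty.2 hs, preimage_empty, preimage_empty, inter_empty]

lemma chartCube_subset_source (p : M) (t : ℝ) : chartCube d p t ⊆ (φ[p]).source :=
  inter_subset_left

lemma chartCube_subset_chartCube (p : M) {s t : ℝ} (h : s ≤ t) :
    chartCube d p s ⊆ chartCube d p t :=
  inter_subset_inter_right _ (preimage_mono (cube_subset_cube _ h))

lemma preimage_inter_chartCube (p : M) (t : ℝ) (A : Set M) :
    (φ[p]).target ∩ (φ[p]).symm ⁻¹' (A ∩ chartCube d p t) =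
      ((φ[p]).target ∩ (φ[p]).symm ⁻¹' A) ∩ cube (φ[p] p) t := by
  ext y
  constructor
  · rintro ⟨h1, h2, h3, h4⟩
    rw [mem_preimage, (φ[p]).right_inv h1] at h4
    exact ⟨⟨h1, h2⟩, h4⟩
  · rintro ⟨⟨h1, h2⟩, h3⟩
    refine ⟨h1, h2, (φ[p]).map_target h1, ?_⟩
    rwa [mem_preimage, (φ[p]).right_inv h1]

lemma preimage_chartCube (p : M) {t : ℝ} (ht : t ≤ 2 * cubeRadius d p) :
    (φ[p]).target ∩ (φ[p]).symm ⁻¹' (chartCube d p t) = cube (φ[p] p) t := by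
  have h := preimage_inter_chartCube (d := d) p t univ
  rw [univ_inter, preimage_univ, inter_univ] at h
  rw [h]
  exact inter_eq_right.2 ((cube_subset_closedCube _ _).trans (closedCube_subset_target p ht))

lemma exists_finset_chartCube_cover (d : ℕ) (M : Type*) [TopologicalSpace M]
    [ChartedSpace (Model d) M] [CompactSpace M] :
    ∃ T : Finset M, ⋃ p ∈ T, chartCube d p (cubeRadius d p) = univ := by
  obtain ⟨T, -, hT⟩ := isCompact_univ.elim_nhds_subcover
    (fun p : M => chartCube d p (cubeRadius d p))
    fun p _ => (isOpen_chartCube p _).mem_nhds (mem_chartCube p (cubeRadius_pos p))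
  exact ⟨T, univ_subset_iff.1 hT⟩

end ChartCubes

/-! ### Comparison with the Euclidean volume -/

section VolumeBounds

variable {d : ℕ} {M : Type*} [TopologicalSpace M] [ChartedSpace (Model d) M]
  [IsManifold (𝓡 d) ∞ M]

local notation "φ[" p "]" => chartAt (Model d) p

lemma exists_density_bounds (g : Metric d M) (p : M) :
    ∃ m Λ : ℝ, 0 < m ∧ 0 < Λ ∧ ∀ y ∈ closedCube (φ[p] p) (2 * cubeRadius d p),
      m ≤ density g p y ∧ density g p y ≤ Λ := by
  have hK := isCompact_closedCube (φ[p] p) (2 * cubeRadius d p)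
  have hKt := closedCube_subset_target (d := d) p le_rfl
  have hc := (contDiffOn_density g p).continuousOn.mono hKt
  have hne : (closedCube (φ[p] p) (2 * cubeRadius d p)).Nonempty :=
    ⟨_, cube_subset_closedCube _ _ (center_mem_cube _ (by linarith [cubeRadius_pos (d := d) p]))⟩
  obtain ⟨a, ha, hamin⟩ := hK.exists_isMinOn hne hc
  obtain ⟨b, hb, hbmax⟩ := hK.exists_isMaxOn hne hc
  exact ⟨density g p a, density g p b, density_pos g p (hKt ha), density_pos g p (hKt hb),
    fun y hy => ⟨hamin hy, hbmax hy⟩⟩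

variable [MeasurableSpace M] [BorelSpace M]

lemma vol_inter_chartCube_le (g : Metric d M) (p : M) {Λ : ℝ}
    (hΛ : ∀ y ∈ closedCube (φ[p] p) (2 * cubeRadius d p), density g p y ≤ Λ) {A : Set M}
    (hA : MeasurableSet A) {t : ℝ} (ht : t ≤ 2 * cubeRadius d p) :
    vol g (A ∩ chartCube d p t) ≤ ENNReal.ofReal Λ *
      volume (((φ[p]).target ∩ (φ[p]).symm ⁻¹' A) ∩ cube (φ[p] p) t) := by
  rw [vol_apply g p (hA.inter (isOpen_chartCube p t).measurableSet)
    (inter_subset_right.trans (chartCube_subset_source p t)), preimage_inter_chartCube p t]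
  refine (setLIntegral_mono_ae' ((measurableSet_chart_preimage p hA).inter
    (isOpen_cube _ _).measurableSet) (ae_of_all _ fun y hy => ENNReal.ofReal_le_ofReal
      (hΛ y (closedCube_subset_closedCube _ ht (cube_subset_closedCube _ _ hy.2))))).trans ?_
  rw [setLIntegral_const]

lemma le_vol_inter_chartCube (g : Metric d M) (p : M) {m : ℝ}
    (hm : ∀ y ∈ closedCube (φ[p] p) (2 * cubeRadius d p), m ≤ density g p y) {A : Set M}
    (hA : MeasurableSet A) {t : ℝ} (ht : t ≤ 2 * cubeRadius d p) :
    ENNReal.ofReal m * volume (((φ[p]).target ∩ (φ[p]).symm ⁻¹' A) ∩ cube (φ[p] p) t) ≤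
      vol g (A ∩ chartCube d p t) := by
  rw [vol_apply g p (hA.inter (isOpen_chartCube p t).measurableSet)
    (inter_subset_right.trans (chartCube_subset_source p t)), preimage_inter_chartCube p t]
  rw [← setLIntegral_const]
  exact setLIntegral_mono_ae' ((measurableSet_chart_preimage p hA).inter
    (isOpen_cube _ _).measurableSet) (ae_of_all _ fun y hy => ENNReal.ofReal_le_ofReal
      (hm y (closedCube_subset_closedCube _ ht (cube_subset_closedCube _ _ hy.2))))

lemma vol_chartCube_lt_top (g : Metric d M) (p : M) :
    vol g (chartCube d p (cubeRadius d p)) < ⊤ := by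
  obtain ⟨m, Λ, -, -, h⟩ := exists_density_bounds g p
  have h0 := cubeRadius_pos (d := d) p
  have h1 := vol_inter_chartCube_le g p (fun y hy => (h y hy).2) MeasurableSet.univ
    (t := cubeRadius d p) (by linarith)
  rw [univ_inter] at h1
  refine h1.trans_lt (ENNReal.mul_lt_top ENNReal.ofReal_lt_top ?_)
  refine (measure_mono inter_subset_right).trans_lt ?_
  rw [volume_cube _ h0]
  exact ENNReal.ofReal_lt_top

instance isFiniteMeasure_vol [CompactSpace M] (g : Metric d M) : IsFiniteMeasure (vol g) := by
  have : IsLocallyFiniteMeasure (vol g) := ⟨fun p => ⟨_, (isOpen_chartCube p _).mem_nhds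
    (mem_chartCube p (cubeRadius_pos (d := d) p)), vol_chartCube_lt_top g p⟩⟩
  exact CompactSpace.isFiniteMeasure

lemma vol_univ_pos [Nonempty M] (g : Metric d M) : 0 < vol g univ := by
  obtain ⟨p⟩ := ‹Nonempty M›
  obtain ⟨m, Λ, hm, -, h⟩ := exists_density_bounds g p
  have h0 := cubeRadius_pos (d := d) p
  have h1 := le_vol_inter_chartCube g p (fun y hy => (h y hy).1) MeasurableSet.univ
    (t := cubeRadius d p) (by linarith)
  have h2 := preimage_inter_chartCube (d := d) p (cubeRadius d p) univ
  rw [univ_inter] at h1 h2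
  rw [← h2, preimage_chartCube p (by linarith), volume_cube _ h0] at h1
  refine lt_of_lt_of_le ?_ (h1.trans (measure_mono (subset_univ _)))
  exact ENNReal.mul_pos (by simpa using hm) (by simpa using by positivity)

end VolumeBounds

/-! ### Smoothness of parametric integrals -/

section ParametricIntegral

variable {W E : Type} [MeasurableSpace W] [NormedAddCommGroup E] [NormedSpace ℝ E]
  [MeasurableSpace E] [BorelSpace E] [SecondCountableTopology E]
  {μ : Measure W} [IsFiniteMeasure μ] {a : W → E} {b : W → ℝ} {C : ℝ}

lemma integrable_translates {G : Type} [NormedAddCommGroup G] [NormedSpace ℝ G]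
    (ha : Measurable a) (hb : Measurable b) (hC : ∀ w, |b w| ≤ C)
    {f : E → G} (hf : Continuous f) (hc : HasCompactSupport f) (x : E) :
    Integrable (fun w => b w • f (x - a w)) μ := by
  obtain ⟨D, hD⟩ := hf.bounded_above_of_compact_support hc
  refine Integrable.mono' (integrable_const (C * D)) ?_ (ae_of_all _ fun w => ?_)
  · exact (hb.stronglyMeasurable.smul (hf.stronglyMeasurable.comp_measurable
      (measurable_const.sub ha))).aestronglyMeasurable
  · rw [norm_smul, Real.norm_eq_abs]
    exact mul_le_mul (hC w) (hD _) (norm_nonneg _) ((abs_nonneg _).trans (hC w))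

lemma hasFDerivAt_integral_translates {G : Type} [NormedAddCommGroup G] [NormedSpace ℝ G]
    (ha : Measurable a) (hb : Measurable b) (hC : ∀ w, |b w| ≤ C)
    {f : E → G} (hf : ContDiff ℝ 1 f) (hc : HasCompactSupport f) (x : E) :
    HasFDerivAt (fun x => ∫ w, b w • f (x - a w) ∂μ) (∫ w, b w • fderiv ℝ f (x - a w) ∂μ) x := by
  have hcf : Continuous (fderiv ℝ f) := hf.continuous_fderiv (by simp)
  obtain ⟨D, hD⟩ := hcf.bounded_above_of_compact_support (hc.fderiv ℝ)
  refine hasFDerivAt_integral_of_dominated_of_fderiv_le (bound := fun _ => C * D) (s := univ)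
    (F' := fun x w => b w • fderiv ℝ f (x - a w)) univ_mem (Eventually.of_forall fun z =>
      (integrable_translates ha hb hC hf.continuous hc z).aestronglyMeasurable)
    (integrable_translates ha hb hC hf.continuous hc x)
    (integrable_translates ha hb hC hcf (hc.fderiv ℝ) x).aestronglyMeasurable
    (ae_of_all _ fun w z _ => ?_) (integrable_const _) (ae_of_all _ fun w z _ => ?_)
  · rw [norm_smul, Real.norm_eq_abs]
    exact mul_le_mul (hC w) (hD _) (norm_nonneg _) ((abs_nonneg _).trans (hC w))
  · have h1 : HasFDerivAt (fun z => z - a w) (ContinuousLinearMap.id ℝ E) z :=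
      (hasFDerivAt_id z).sub_const (a w)
    have h2 := ((hf.differentiable (by simp) (z - a w)).hasFDerivAt.comp z h1).const_smul (b w)
    rwa [ContinuousLinearMap.comp_id] at h2

/-- An average of translates of a smooth function with compact support is smooth. -/
lemma contDiff_integral_translates (ha : Measurable a) (hb : Measurable b) (hC : ∀ w, |b w| ≤ C)
    (n : ℕ) : ∀ {G : Type} [NormedAddCommGroup G] [NormedSpace ℝ G] {f : E → G}
    (_ : ContDiff ℝ ∞ f) (_ : HasCompactSupport f),
    ContDiff ℝ n (fun x => ∫ w, b w • f (x - a w) ∂μ) := by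
  induction n with
  | zero =>
    intro G _ _ f hf hc
    have h : Differentiable ℝ (fun x => ∫ w, b w • f (x - a w) ∂μ) := fun x =>
      (hasFDerivAt_integral_translates ha hb hC (hf.of_le (by norm_cast)) hc x).differentiableAt
    exact contDiff_zero.2 h.continuous
  | succ n ih =>
    intro G _ _ f hf hc
    have h1 := hasFDerivAt_integral_translates (μ := μ) ha hb hC
      (hf.of_le (by norm_cast)) hc
    rw [Nat.cast_succ, contDiff_succ_iff_fderiv]
    refine ⟨fun x => (h1 x).differentiableAt, by simp, ?_⟩
    have h2 : fderiv ℝ (fun x => ∫ w, b w • f (x - a w) ∂μ) =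
        fun x => ∫ w, b w • fderiv ℝ f (x - a w) ∂μ := funext fun x => (h1 x).fderiv
    rw [h2]
    exact ih (hf.fderiv_right (by simp)) (hc.fderiv ℝ)

end ParametricIntegral

/-! ### Small fields of prescribed divergence on cubes -/

section Primitive

variable {d : ℕ}

/-- A smooth function with compact support is, up to a small multiple of its integral, bounded by
the divergence of a field of size `ε`. The field is the average over `z` in a cube of side `2ε` of
`x ↦ ∫ s in 0..1, f (x - s z) z`, whose divergence is `f` minus the average of `f` over the cube
around `x`. -/
lemma exists_field_euclDiv_ge {f : Model d → ℝ} (hf : ContDiff ℝ ∞ f) (hf0 : ∀ y, 0 ≤ f y)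
    (hf1 : ∀ y, f y ≤ 1) {c : Model d} {r ε : ℝ} (hr : 0 ≤ r) (hε : 0 < ε)
    (hsupp : ∀ y ∉ closedCube c r, f y = 0) :
    ∃ F : Model d → Model d, ContDiff ℝ ∞ F ∧ (∀ y ∉ closedCube c (r + ε), F y = 0) ∧
      (∀ y i, |F y i| ≤ ε) ∧
      ∀ y, f y - ((2 * ε) ^ d)⁻¹ * ∫ z, f z ≤ euclDiv F y := by
  have hc : HasCompactSupport f := HasCompactSupport.intro (isCompact_closedCube c r) hsupp
  set κ : ℝ := ((2 * ε) ^ d)⁻¹ with hκ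
  have hκ0 : 0 < κ := by positivity
  set B : Set (Model d) := cube 0 ε with hB
  have hBm : MeasurableSet B := (isOpen_cube 0 ε).measurableSet
  have hBz : ∀ z ∈ B, ∀ i, |z i| < ε := fun z hz i => by simpa using (mem_cube hε).1 hz i
  have hvB : volume B = ENNReal.ofReal ((2 * ε) ^ d) := volume_cube 0 hε
  have hvB' : volume.real B = (2 * ε) ^ d := by
    rw [Measure.real, hvB, ENNReal.toReal_ofReal (by positivity)]
  have : IsFiniteMeasure (volume.restrict B) := ⟨by
    rw [Measure.restrict_apply_univ, hvB]; exact ENNReal.ofReal_lt_top⟩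
  set μ : Measure (Model d × ℝ) :=
    (volume.restrict B).prod (volume.restrict (Icc (0:ℝ) 1)) with hμ
  set a : Model d × ℝ → Model d := fun w => w.2 • w.1 with ha
  have ham : Measurable a := measurable_snd.smul measurable_fst
  -- The truncated coordinates of `z`; the truncation is not seen by `μ`.
  set b : Fin d → Model d × ℝ → ℝ := fun i w => max (-ε) (min (w.1 i) ε) with hb
  have hbm : ∀ i, Measurable (b i) := fun i => by
    have h1 : Measurable fun w : Model d × ℝ => w.1 i :=
      ((EuclideanSpace.proj i : Model d →L[ℝ] ℝ).continuous.measurable).comp measurable_fst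
    exact measurable_const.max (h1.min measurable_const)
  have hbC : ∀ i w, |b i w| ≤ ε := fun i w =>
    abs_le.2 ⟨le_max_left _ _, max_le (by linarith) (min_le_right _ _)⟩
  have hbB : ∀ i, ∀ w : Model d × ℝ, w.1 ∈ B → b i w = w.1 i := fun i w hw => by
    have := abs_lt.1 (hBz _ hw i)
    simp only [hb]
    rw [min_eq_left this.2.le, max_eq_right this.1.le]
  have hμae : ∀ᵐ w ∂μ, w.1 ∈ B ∧ w.2 ∈ Icc (0:ℝ) 1 := by
    rw [hμ, Measure.prod_restrict]
    filter_upwards [ae_restrict_mem (hBm.prod measurableSet_Icc)] with w hw using hw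
  set φ : Fin d → Model d → ℝ := fun i x => κ * ∫ w, b i w • f (x - a w) ∂μ with hφ
  have hφs : ∀ i, ContDiff ℝ ∞ (φ i) := fun i => contDiff_const.mul (contDiff_infty.2 fun n =>
    contDiff_integral_translates ham (hbm i) (hbC i) n hf hc)
  have hφ0 : ∀ i, ∀ y ∉ closedCube c (r + ε), φ i y = 0 := by
    intro i y hy
    have : ∀ᵐ w ∂μ, b i w • f (y - a w) = 0 := by
      filter_upwards [hμae] with w hw
      rw [hsupp, smul_zero]
      intro hmem
      apply hy
      rw [mem_closedCube hr] at hmem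
      rw [mem_closedCube (by positivity)]
      intro j
      have h1 := hmem j
      have h2 := (hBz _ hw.1 j).le
      have h3 : |w.2 * w.1 j| ≤ ε := by
        rw [abs_mul, abs_of_nonneg hw.2.1]
        nlinarith [hw.2.2, abs_nonneg (w.1 j), hw.2.1]
      have h4 : y j - c j = ((y - a w) j - c j) + w.2 * w.1 j := by
        simp [ha]
        ring
      rw [h4]
      exact (abs_add_le _ _).trans (add_le_add h1 h3)
    simp only [hφ]
    rw [integral_congr_ae this]
    simp
  have hμreal : μ.real univ = (2 * ε) ^ d := by
    rw [hμ, Measure.real, ← univ_prod_univ, Measure.prod_prod, Measure.restrict_apply_univ,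
      Measure.restrict_apply_univ, hvB, Real.volume_Icc, sub_zero, ENNReal.ofReal_one, mul_one,
      ENNReal.toReal_ofReal (by positivity)]
  refine ⟨fun x => WithLp.toLp 2 fun i => φ i x, ?_, ?_, ?_, ?_⟩
  · rw [contDiff_euclidean]
    exact hφs
  · intro y hy
    ext i
    exact hφ0 i y hy
  · intro y i
    have h1 : ‖∫ w, b i w • f (y - a w) ∂μ‖ ≤ ε * μ.real univ := by
      refine norm_integral_le_of_norm_le_const (ae_of_all _ fun w => ?_)
      rw [norm_smul, Real.norm_eq_abs, Real.norm_eq_abs, abs_of_nonneg (hf0 _)]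
      calc |b i w| * f (y - a w) ≤ ε * 1 := mul_le_mul (hbC i w) (hf1 _) (hf0 _) hε.le
        _ = ε := mul_one _
    simp only [hφ, abs_mul, abs_of_pos hκ0]
    calc κ * |∫ w, b i w • f (y - a w) ∂μ| ≤ κ * (ε * μ.real univ) :=
          mul_le_mul_of_nonneg_left h1 hκ0.le
      _ = ε := by rw [hμreal, hκ]; field_simp
  · intro y
    have hfd : ContDiff ℝ ∞ (fderiv ℝ f) := hf.fderiv_right (by simp)
    have hD := fun i => hasFDerivAt_integral_translates (μ := μ) ham (hbm i) (hbC i)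
      (hf.of_le (by norm_cast)) hc y
    have hint : ∀ i, Integrable (fun w => b i w • fderiv ℝ f (y - a w)) μ := fun i =>
      integrable_translates ham (hbm i) (hbC i) hfd.continuous (hc.fderiv ℝ) y
    have h1 : euclDiv (fun x => WithLp.toLp 2 fun i => φ i x) y =
        κ * ∫ w, fderiv ℝ f (y - a w) w.1 ∂μ := by
      have h2 : ∀ i, fderiv ℝ (φ i) y (EuclideanSpace.single i 1) =
          κ * ∫ w, b i w * fderiv ℝ f (y - a w) (EuclideanSpace.single i 1) ∂μ := by
        intro i
        rw [((hD i).const_mul κ).fderiv, smul_apply, smul_eq_mul,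
          ContinuousLinearMap.integral_apply (hint i)]
        rfl
      simp only [euclDiv]
      rw [Finset.sum_congr rfl fun i _ => h2 i, ← Finset.mul_sum, ← integral_finsetSum]
      · congr 1
        refine integral_congr_ae ?_
        filter_upwards [hμae] with w hw
        conv_rhs => rw [eq_sum_single w.1, map_sum]
        refine Finset.sum_congr rfl fun i _ => ?_
        rw [hbB i w hw.1, map_smul, smul_eq_mul]
      · intro i _
        exact (hint i).apply_continuousLinearMap _
    have hcontD : Continuous fun w : Model d × ℝ => fderiv ℝ f (y - a w) w.1 :=
      (hfd.continuous.comp (continuous_const.sub (continuous_snd.smul continuous_fst))).clm_apply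
        continuous_fst
    have hintD : Integrable (fun w => fderiv ℝ f (y - a w) w.1) μ := by
      have h3 : Integrable (fun w => ∑ i, (b i w • fderiv ℝ f (y - a w))
          (EuclideanSpace.single i 1)) μ :=
        integrable_finsetSum _ fun i _ => (hint i).apply_continuousLinearMap _
      refine h3.congr ?_
      filter_upwards [hμae] with w hw
      conv_rhs => rw [eq_sum_single w.1, map_sum]
      refine Finset.sum_congr rfl fun i _ => ?_
      rw [hbB i w hw.1, map_smul, smul_eq_mul]
      rfl
    have hinner : ∀ z : Model d, ∫ s in Icc (0:ℝ) 1, fderiv ℝ f (y - s • z) z = f y - f (y - z) := by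
      intro z
      have hder : ∀ s : ℝ, HasDerivAt (fun s : ℝ => - f (y - s • z)) (fderiv ℝ f (y - s • z) z) s := by
        intro s
        have h4 : HasDerivAt (fun s : ℝ => y - s • z) (-z) s := by
          simpa using ((hasDerivAt_id s).smul_const z).const_sub y
        have h5 := ((hf.differentiable (by simp) (y - s • z)).hasFDerivAt.comp_hasDerivAt s h4).neg
        exact h5.congr_deriv (by simp)
      rw [integral_Icc_eq_integral_Ioc, ← intervalIntegral.integral_of_le zero_le_one,
        intervalIntegral.integral_eq_sub_of_hasDerivAt (fun s _ => hder s)]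
      · simp; ring
      · exact ((hfd.continuous.comp (continuous_const.sub
          (continuous_id.smul continuous_const))).clm_apply continuous_const).intervalIntegrable _ _
    have hfy : Integrable (fun z => f (y - z)) := by
      have := hf.continuous.integrable_of_hasCompactSupport (μ := volume) hc
      exact this.comp_sub_left y
    rw [h1, hμ, integral_prod _ hintD]
    simp only [ha]
    simp only [hinner]
    rw [integral_sub (integrable_const _) hfy.integrableOn, integral_const]
    have h6 : ∫ z in B, f (y - z) ≤ ∫ z, f z := by
      calc ∫ z in B, f (y - z) ≤ ∫ z, f (y - z) :=
            setIntegral_le_integral hfy (ae_of_all _ fun z => hf0 _)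
        _ = ∫ z, f z := integral_sub_left_eq_self f volume y
    have h7 : κ * (2 * ε) ^ d = 1 := inv_mul_cancel₀ (by positivity)
    rw [measureReal_restrict_apply_univ, hvB', smul_eq_mul, mul_sub, ← mul_assoc, h7, one_mul]
    exact sub_le_sub_left (mul_le_mul_of_nonneg_left h6 hκ0.le) _

end Primitive

/-! ### Comparison with the Euclidean length -/

section MetricBounds

variable {d : ℕ} {M : Type*} [TopologicalSpace M] [ChartedSpace (Model d) M]
  [IsManifold (𝓡 d) ∞ M]

local notation "φ[" p "]" => chartAt (Model d) p

/-- In a coordinate cube the metric is bounded by the Euclidean one. -/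
lemma exists_metricForm_le (g : Metric d M) (p : M) :
    ∃ C : ℝ, 1 ≤ C ∧ ∀ y ∈ closedCube (φ[p] p) (2 * cubeRadius d p), ∀ (a : ℝ) (v : Model d),
      (∀ i, |v i| ≤ a) →
        metricForm g ((φ[p]).symm y) (pushMap p y v) (pushMap p y v) ≤ C * a ^ 2 := by
  have hKt := closedCube_subset_target (d := d) p le_rfl
  have hc : ContinuousOn (fun y => ∑ i, ∑ j, |gram g p y i j|)
      (closedCube (φ[p] p) (2 * cubeRadius d p)) :=
    continuousOn_finsetSum _ fun i _ => continuousOn_finsetSum _ fun j _ =>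
      ((contDiffOn_gram g p i j).continuousOn.mono hKt).abs
  obtain ⟨C, hC⟩ := (isCompact_closedCube (φ[p] p) (2 * cubeRadius d p)).bddAbove_image hc
  refine ⟨max C 1, le_max_right _ _, fun y hy a v hv => ?_⟩
  rw [metricForm_pushMap]
  have h1 : ∑ i, ∑ j, |gram g p y i j| ≤ max C 1 :=
    (hC ⟨y, hy, rfl⟩).trans (le_max_left _ _)
  refine le_trans ?_ (mul_le_mul_of_nonneg_right h1 (sq_nonneg a))
  simp only [Finset.sum_mul]
  refine Finset.sum_le_sum fun i _ => Finset.sum_le_sum fun j _ => ?_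
  refine (le_abs_self _).trans ?_
  rw [abs_mul, mul_comm]
  refine mul_le_mul_of_nonneg_left ?_ (abs_nonneg _)
  rw [abs_mul, sq]
  exact mul_le_mul (hv i) (hv j) (abs_nonneg _) ((abs_nonneg _).trans (hv i))

/-- In a coordinate cube the metric is bounded below by the Euclidean one: vectors of length at
most one have bounded components. -/
lemma exists_coord_le (g : Metric d M) (p : M) :
    ∃ C : ℝ, 0 < C ∧ ∀ y ∈ closedCube (φ[p] p) (2 * cubeRadius d p), ∀ v : Model d,
      metricForm g ((φ[p]).symm y) (pushMap p y v) (pushMap p y v) ≤ 1 → ∀ i, |v i| ≤ C := by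
  have hKt := closedCube_subset_target (d := d) p le_rfl
  set K := closedCube (φ[p] p) (2 * cubeRadius d p) with hK
  have hc : ContinuousOn (fun x : Model d × Model d => ∑ i, ∑ j, x.2 i * x.2 j * gram g p x.1 i j)
      (K ×ˢ Metric.sphere 0 1) := by
    refine continuousOn_finsetSum _ fun i _ => continuousOn_finsetSum _ fun j _ => ?_
    have h1 : ContinuousOn (fun x : Model d × Model d => gram g p x.1 i j)
        (K ×ˢ Metric.sphere 0 1) :=
      ((contDiffOn_gram g p i j).continuousOn.mono hKt).comp continuousOn_fst fun x hx => hx.1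
    have h2 : ∀ i, Continuous fun x : Model d × Model d => x.2 i := fun i =>
      (EuclideanSpace.proj i : Model d →L[ℝ] ℝ).continuous.comp continuous_snd
    exact ((h2 i).mul (h2 j)).continuousOn.mul h1
  obtain ⟨m, hm0, hm⟩ := ((isCompact_closedCube _ _).prod (isCompact_sphere (0 : Model d)
    1)).exists_forall_le' hc (a := 0) fun x hx => by
      rw [← metricForm_pushMap]
      exact metricForm_pos g _ (pushMap_ne_zero p (hKt hx.1) (ne_zero_of_mem_unit_sphere ⟨x.2, hx.2⟩))
  refine ⟨1 / √m, by positivity, fun y hy v hv i => ?_⟩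
  have hvi : |v i| ≤ ‖v‖ := PiLp.norm_apply_le v i
  refine hvi.trans ?_
  by_cases hv0 : v = 0
  · rw [hv0, norm_zero]; positivity
  have hn : 0 < ‖v‖ := norm_pos_iff.2 hv0
  have h1 := hm (y, ‖v‖⁻¹ • v) ⟨hy, by simp [norm_smul, hn.ne']⟩
  rw [metricForm_pushMap] at hv
  have h2 : ∑ i, ∑ j, (‖v‖⁻¹ • v) i * (‖v‖⁻¹ • v) j * gram g p y i j =
      (‖v‖⁻¹) ^ 2 * ∑ i, ∑ j, v i * v j * gram g p y i j := by
    simp only [Finset.mul_sum, PiLp.smul_apply, smul_eq_mul]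
    exact Finset.sum_congr rfl fun i _ => Finset.sum_congr rfl fun j _ => by ring
  simp only at h1
  rw [h2] at h1
  have h3 : m * ‖v‖ ^ 2 ≤ 1 := by
    have h4 := mul_le_mul_of_nonneg_right h1 (sq_nonneg ‖v‖)
    have h5 : (‖v‖⁻¹) ^ 2 * (∑ i, ∑ j, v i * v j * gram g p y i j) * ‖v‖ ^ 2 =
        ∑ i, ∑ j, v i * v j * gram g p y i j := by field_simp
    linarith
  rw [le_div_iff₀ (by positivity)]
  refine le_of_sq_le_sq ?_ zero_le_one
  rw [mul_pow, Real.sq_sqrt hm0.le]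
  linarith

end MetricBounds

/-! ### The isoperimetric inequality for small volumes -/

section Isoperimetric

variable {d : ℕ} {M : Type*} [TopologicalSpace M] [ChartedSpace (Model d) M]
  [IsManifold (𝓡 d) ∞ M] [MeasurableSpace M] [BorelSpace M] [T2Space M] [CompactSpace M]

local notation "φ[" p "]" => chartAt (Model d) p

lemma le_boundaryMass (g : Metric d M) {Ω U : Set M} {X : VField d M} (hX : X ∈ testFields g U) :
    ENNReal.ofReal (∫ p in Ω, divergence g X p ∂(vol g)) ≤ boundaryMass g Ω U :=
  le_iSup₂ (f := fun (X : VField d M) (_ : X ∈ testFields g U) =>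
    ENNReal.ofReal (∫ p in Ω, divergence g X p ∂(vol g))) X hX

/-- A smooth function that approximates the indicator of a set of finite measure. -/
lemma exists_smooth_approx {E V : Set (Model d)} (hE : MeasurableSet E) (hV : IsOpen V)
    (hEV : E ⊆ V) (hE0 : volume E ≠ 0) (hE1 : volume E ≠ ⊤) :
    ∃ f : Model d → ℝ, ContDiff ℝ ∞ f ∧ (∀ y, 0 ≤ f y) ∧ (∀ y, f y ≤ 1) ∧ (∀ y ∉ V, f y = 0) ∧
      volume.real E / 2 ≤ ∫ y in E, f y ∧ ∫ y, f y ≤ 2 * ∫ y in E, f y := by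
  obtain ⟨K, hKE, hK, hKv⟩ := hE.exists_lt_isCompact (ENNReal.half_lt_self hE0 hE1)
  have hK0 : volume K ≠ 0 := (bot_le.trans_lt hKv).ne'
  have hK1 : volume K ≠ ⊤ := hK.measure_lt_top.ne
  have hK2 : volume K < 2 * volume K := by
    rw [two_mul]; exact ENNReal.lt_add_right hK1 hK0
  obtain ⟨U, hKU, hU, hUv⟩ := hK.exists_isOpen_lt_of_lt _ hK2
  obtain ⟨f, hf, hfr, hfs, hf1⟩ := exists_contMDiff_zero_iff_one_iff_of_isClosed
    (n := (⊤ : ℕ∞)) 𝓘(ℝ, Model d) (hU.inter hV).isClosed_compl hK.isClosed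
    (disjoint_compl_left_iff_subset.2 (subset_inter hKU (hKE.trans hEV)))
  have h01 : ∀ y, f y ∈ Icc (0:ℝ) 1 := fun y => hfr (mem_range_self y)
  have hfc := hf.contDiff.continuous
  have hU1 : volume (U ∩ V) ≠ ⊤ := ((measure_mono inter_subset_left).trans_lt
    (hUv.trans (ENNReal.mul_lt_top (by simp) hK1.lt_top))).ne
  have hint : ∀ S : Set (Model d), volume S ≠ ⊤ → IntegrableOn f S := fun S hS =>
    Measure.integrableOn_of_bounded (M := 1) hS hfc.aestronglyMeasurable
      (ae_of_all _ fun y => by rw [Real.norm_eq_abs, abs_of_nonneg (h01 y).1]; exact (h01 y).2)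
  have hf0 : ∀ y ∉ U ∩ V, f y = 0 := fun y hy => (hfs y).1 hy
  have h1 : volume.real K ≤ ∫ y in E, f y := by
    calc volume.real K = ∫ y in K, f y := by
          rw [setIntegral_congr_fun hK.measurableSet fun y hy => (hf1 y).1 hy]
          simp
      _ ≤ _ := setIntegral_mono_set (hint E hE1) (ae_of_all _ fun y => (h01 y).1)
          (LE.le.eventuallyLE hKE)
  refine ⟨f, hf.contDiff, fun y => (h01 y).1, fun y => (h01 y).2,
    fun y hy => hf0 y fun h => hy h.2, ?_, ?_⟩
  · refine le_trans ?_ h1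
    have h2 := ENNReal.toReal_mono hK1 hKv.le
    rw [ENNReal.toReal_div] at h2
    exact h2
  · have h2 : ∫ y, f y = ∫ y in U ∩ V, f y :=
      (setIntegral_eq_integral_of_forall_compl_eq_zero hf0).symm
    have h3 : ∫ y in U ∩ V, f y ≤ volume.real (U ∩ V) := by
      calc ∫ y in U ∩ V, f y ≤ ∫ y in U ∩ V, (1:ℝ) :=
            setIntegral_mono (hint _ hU1) (integrableOn_const hU1) fun y => (h01 y).2
        _ = _ := by simp
    have h4 : volume.real (U ∩ V) ≤ 2 * volume.real K := by
      have h5 := ENNReal.toReal_mono (ENNReal.mul_ne_top (by simp) hK1)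
        ((measure_mono inter_subset_left).trans hUv.le : volume (U ∩ V) ≤ 2 * volume K)
      rw [ENNReal.toReal_mul] at h5
      exact h5
    rw [h2]
    linarith

/-- A weak isoperimetric inequality in one chart. -/
lemma exists_chart_isoperimetric (g : Metric d M) (p : M) {K : ℝ} (hK : 0 < K) :
    ∃ v > 0, ∀ Ω : Set M, MeasurableSet Ω → (vol g).real Ω ≤ v →
      ENNReal.ofReal (K * (vol g).real (Ω ∩ chartCube d p (cubeRadius d p))) ≤
        boundaryMass g Ω univ := by
  obtain ⟨m, Λ, hm, hΛ, hb⟩ := exists_density_bounds g p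
  obtain ⟨C, hC, hCb⟩ := exists_metricForm_le g p
  have hR := cubeRadius_pos (d := d) p
  set R := cubeRadius d p with hRdef
  set c := φ[p] p with hc
  set ε := min (R / 2) (m / (4 * C * Λ * K)) with hε
  have hε0 : 0 < ε := lt_min (by positivity) (by positivity)
  set κ : ℝ := ((2 * ε) ^ d)⁻¹ with hκ
  have hκ0 : 0 < κ := by positivity
  refine ⟨m / (4 * κ), by positivity, fun Ω hΩ hv => ?_⟩
  set E' := (φ[p]).target ∩ (φ[p]).symm ⁻¹' Ω with hE'
  have hE'm : MeasurableSet E' := measurableSet_chart_preimage p hΩ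
  set E := E' ∩ cube c R with hE
  have hEm : MeasurableSet E := hE'm.inter (isOpen_cube _ _).measurableSet
  set E2 := E' ∩ cube c (2 * R) with hE2
  have hE2m : MeasurableSet E2 := hE'm.inter (isOpen_cube _ _).measurableSet
  have hEE2 : E ⊆ E2 := inter_subset_inter_right _ (cube_subset_cube _ (by linarith))
  have hE2top : volume E2 ≠ ⊤ := by
    refine ((measure_mono inter_subset_right).trans_lt ?_).ne
    rw [volume_cube _ (by positivity)]
    exact ENNReal.ofReal_lt_top
  have hEtop : volume E ≠ ⊤ := ((measure_mono hEE2).trans_lt hE2top.lt_top).ne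
  -- Comparison of the Riemannian with the Euclidean volume.
  have hvolE : (vol g).real (Ω ∩ chartCube d p R) ≤ Λ * volume.real E := by
    have h1 := vol_inter_chartCube_le g p (fun y hy => (hb y hy).2) hΩ (t := R) (by linarith)
    have h2 := ENNReal.toReal_mono (ENNReal.mul_ne_top ENNReal.ofReal_ne_top hEtop) h1
    rwa [ENNReal.toReal_mul, ENNReal.toReal_ofReal hΛ.le] at h2
  have hvolE2 : m * volume.real E2 ≤ m / (4 * κ) := by
    have h1 := (le_vol_inter_chartCube g p (fun y hy => (hb y hy).1) hΩ (t := 2 * R) le_rfl).trans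
      (measure_mono inter_subset_left)
    have h2 := ENNReal.toReal_mono (measure_ne_top _ _) h1
    rw [ENNReal.toReal_mul, ENNReal.toReal_ofReal hm.le] at h2
    exact h2.trans hv
  by_cases hE0 : volume E = 0
  · have : (vol g).real (Ω ∩ chartCube d p R) = 0 := by
      refine le_antisymm (hvolE.trans ?_) measureReal_nonneg
      simp [Measure.real, hE0]
    rw [this]
    simp
  obtain ⟨f, hf, hf0, hf1, hfs, hfE, hfI⟩ := exists_smooth_approx hEm (isOpen_cube c R)
    inter_subset_right hE0 hEtop
  obtain ⟨F, hF, hFs, hFb, hFd⟩ := exists_field_euclDiv_ge hf hf0 hf1 hR.le hε0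
    (c := c) fun y hy => hfs y fun h => hy (cube_subset_closedCube _ _ h)
  have hRε : R + ε ≤ 2 * R := by linarith [min_le_left (R / 2) (m / (4 * C * Λ * K))]
  have hKt : closedCube c (R + ε) ⊆ (φ[p]).target := closedCube_subset_target p hRε
  have hKc := isCompact_closedCube c (R + ε)
  -- The field is normalised by `s` so that its Riemannian length is at most one.
  set s := m / (ε * C) with hs
  have hs0 : 0 < s := by positivity
  set G : Model d → Model d := fun y => (s * (density g p y)⁻¹) • F y with hG
  have hG0 : ∀ y ∉ closedCube c (R + ε), G y = 0 := fun y hy => by rw [hG]; simp [hFs y hy]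
  have hGs : ContDiff ℝ ∞ G := by
    rw [contDiff_iff_contDiffAt]
    intro y
    by_cases hy : y ∈ (φ[p]).target
    · have h1 : ContDiffAt ℝ ∞ (density g p) y :=
        (contDiffOn_density g p).contDiffAt ((φ[p]).open_target.mem_nhds hy)
      exact (contDiffAt_const.mul (h1.inv (density_pos g p hy).ne')).smul hF.contDiffAt
    · refine (contDiffAt_const (c := (0 : Model d))).congr_of_eventuallyEq ?_
      filter_upwards [hKc.isClosed.isOpen_compl.mem_nhds fun h => hy (hKt h)] with z hz
      exact hG0 z hz
  obtain ⟨X, hXc, hXs, hX0⟩ := exists_vfield_of_coord p hGs hKc hKt hG0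
  have hXtest : X ∈ testFields g univ := by
    refine ⟨HasCompactSupport.of_compactSpace _, subset_univ _, fun q => ?_⟩
    by_cases hq : q ∈ (φ[p]).symm '' closedCube c (R + ε)
    · obtain ⟨y, hy, rfl⟩ := hq
      have h1 := hXs _ ((φ[p]).map_target (hKt hy))
      rw [(φ[p]).right_inv (hKt hy)] at h1
      have hy2 := closedCube_subset_closedCube c hRε hy
      have h2 := hCb y hy2 (1 / C) (G y) fun i => by
        have h3 := (hb y hy2).1
        have h4 := density_pos g p (hKt hy)
        simp only [hG, PiLp.smul_apply, smul_eq_mul, abs_mul, abs_inv, abs_of_pos hs0,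
          abs_of_pos h4]
        calc s * (density g p y)⁻¹ * |F y i| ≤ s * m⁻¹ * ε := by
              gcongr
              exact hFb y i
          _ = 1 / C := by rw [hs]; field_simp
      have h5 : C * (1 / C) ^ 2 ≤ 1 := by
        rw [div_pow, one_pow, mul_one_div, div_le_one (by positivity)]
        nlinarith
      refine le_trans (le_of_eq ?_) (h2.trans h5)
      rw [h1]
      rfl
    · rw [hX0 q hq]
      simp
  -- The flux of the field.
  have hXint : ∫ q in Ω, divergence g X q ∂(vol g) = s * ∫ y in E2, euclDiv F y := by
    have hsrc := (φ[p]).open_source.measurableSet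
    have hcl := (isCompact_chart_symm_image p hKc hKt).isClosed
    have h1 : ∫ q in Ω, divergence g X q ∂(vol g) =
        ∫ q in Ω ∩ (φ[p]).source, divergence g X q ∂(vol g) := by
      refine setIntegral_eq_of_subset_of_forall_sdiff_eq_zero hΩ inter_subset_left
        fun q hq => ?_
      have hq' : q ∉ (φ[p]).symm '' closedCube c (R + ε) := by
        rintro ⟨y, hy, rfl⟩
        exact hq.2 ⟨hq.1, (φ[p]).map_target (hKt hy)⟩
      refine divergence_eq_zero g ?_
      filter_upwards [hcl.isOpen_compl.mem_nhds hq'] with z hz using hX0 z hz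
    have h2 : (φ[p]).target ∩ (φ[p]).symm ⁻¹' (Ω ∩ (φ[p]).source) = E' := by
      ext y
      exact ⟨fun h => ⟨h.1, h.2.1⟩, fun h => ⟨h.1, h.2, (φ[p]).map_target h.1⟩⟩
    rw [h1, setIntegral_vol g p (hΩ.inter hsrc) inter_subset_right
      (continuous_divergence g X).stronglyMeasurable, h2,
      setIntegral_congr_fun hE'm fun y hy => density_mul_divergence g X p hy.1]
    have h3 : ∀ y ∈ E', euclDiv (weightedField g X p) y = s * euclDiv F y := by
      intro y hy
      have h4 : ∀ᶠ z in 𝓝 y, weightedField g X p z = s • F z := by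
        filter_upwards [(φ[p]).open_target.mem_nhds hy.1] with z hz
        rw [weightedField, hXc z hz, hG, smul_smul]
        have := (density_pos g p hz).ne'
        congr 1
        field_simp
      simp only [euclDiv, Finset.mul_sum]
      refine Finset.sum_congr rfl fun i _ => ?_
      have h5 : (fun z => weightedField g X p z i) =ᶠ[𝓝 y] fun z => s * F z i := by
        filter_upwards [h4] with z hz
        rw [hz]; rfl
      have h6 : DifferentiableAt ℝ (fun z => F z i) y :=
        (EuclideanSpace.proj i : Model d →L[ℝ] ℝ).differentiableAt.comp y
          (hF.differentiable (by simp) y)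
      rw [h5.fderiv_eq, fderiv_const_mul h6]
      rfl
    rw [setIntegral_congr_fun hE'm h3, integral_const_mul]
    congr 1
    refine setIntegral_eq_of_subset_of_forall_sdiff_eq_zero (s := E2) hE'm inter_subset_left
      fun y hy => ?_
    have hy2 : y ∉ closedCube c (R + ε) := by
      intro h
      refine hy.2 ⟨hy.1, ?_⟩
      rw [mem_cube (by positivity)]
      rw [mem_closedCube (by positivity)] at h
      intro i
      have := min_le_left (R / 2) (m / (4 * C * Λ * K))
      linarith [h i]
    refine Finset.sum_eq_zero fun i _ => ?_
    have h5 : (fun z => F z i) =ᶠ[𝓝 y] fun _ => 0 := by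
      filter_upwards [hKc.isClosed.isOpen_compl.mem_nhds hy2] with z hz
      rw [hFs z hz]; rfl
    rw [h5.fderiv_eq]
    simp
  refine le_trans (ENNReal.ofReal_le_ofReal ?_) (le_boundaryMass g hXtest)
  rw [hXint]
  have hfint : ∀ S, IntegrableOn f S := fun S =>
    (hf.continuous.integrable_of_hasCompactSupport (HasCompactSupport.intro
      (isCompact_closedCube c R) fun y hy => hfs y fun h => hy
        (cube_subset_closedCube _ _ h))).integrableOn
  have hdint : IntegrableOn (euclDiv F) E2 := by
    have h1 : Continuous (euclDiv F) :=
      continuousOn_univ.1 (continuousOn_euclDiv isOpen_univ hF.contDiffOn)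
    exact (h1.continuousOn.integrableOn_compact (isCompact_closedCube c (2 * R))).mono_set
      (inter_subset_right.trans (cube_subset_closedCube _ _))
  have h1 : (∫ y in E2, f y) - κ * (∫ z, f z) * volume.real E2 ≤ ∫ y in E2, euclDiv F y := by
    have h2 := setIntegral_mono ((hfint E2).sub (integrableOn_const hE2top)) hdint hFd
    change ∫ x in E2, (f x - κ * ∫ z, f z) ≤ _ at h2
    rw [integral_sub (hfint E2) (integrableOn_const hE2top), setIntegral_const, smul_eq_mul,
      mul_comm (volume.real E2)] at h2
    exact h2
  have h2 : ∫ y in E, f y ≤ ∫ y in E2, f y :=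
    setIntegral_mono_set (hfint E2) (ae_of_all _ hf0) (LE.le.eventuallyLE hEE2)
  have h3 : volume.real E2 * κ ≤ 1 / 4 := by
    have h4 : volume.real E2 ≤ 1 / (4 * κ) := by
      have h5 : m / (4 * κ) = m * (1 / (4 * κ)) := by ring
      rw [h5] at hvolE2
      exact le_of_mul_le_mul_left hvolE2 hm
    calc volume.real E2 * κ ≤ 1 / (4 * κ) * κ := by gcongr
      _ = 1 / 4 := by field_simp
  have hE0' : 0 ≤ volume.real E := measureReal_nonneg
  have hkf : κ * (∫ z, f z) * volume.real E2 ≤ (∫ y in E, f y) / 2 := by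
    have h5 : 0 ≤ ∫ z, f z := integral_nonneg hf0
    calc κ * (∫ z, f z) * volume.real E2 = (∫ z, f z) * (volume.real E2 * κ) := by ring
      _ ≤ (∫ z, f z) * (1 / 4) := by gcongr
      _ ≤ _ := by linarith
  have h6 : volume.real E / 4 ≤ ∫ y in E2, euclDiv F y := by
    have h9 : (∫ y in E, f y) - (∫ y in E, f y) / 2 ≤ ∫ y in E2, euclDiv F y :=
      (sub_le_sub h2 hkf).trans h1
    linarith
  have h7 : K * Λ * 4 ≤ s := by
    rw [hs, le_div_iff₀ (by positivity)]
    have h8 := min_le_right (R / 2) (m / (4 * C * Λ * K))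
    rw [← hε, le_div_iff₀ (by positivity)] at h8
    linarith
  calc K * (vol g).real (Ω ∩ chartCube d p R) ≤ K * (Λ * volume.real E) := by gcongr
    _ = (K * Λ * 4) * (volume.real E / 4) := by ring
    _ ≤ s * (volume.real E / 4) := by gcongr
    _ ≤ s * ∫ y in E2, euclDiv F y := by gcongr

/-- A weak isoperimetric inequality: sets of small volume have a boundary mass that is large in
comparison with their volume. -/
lemma exists_isoperimetric [Nonempty M] (g : Metric d M) {K : ℝ} (hK : 0 < K) :
    ∃ v > 0, ∀ Ω : Set M, MeasurableSet Ω → (vol g).real Ω ≤ v →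
      ENNReal.ofReal (K * (vol g).real Ω) ≤ boundaryMass g Ω univ := by
  obtain ⟨T, hT⟩ := exists_finset_chartCube_cover d M
  have hTne : T.Nonempty := by
    rw [Finset.nonempty_iff_ne_empty]
    rintro rfl
    simp only [Finset.notMem_empty, iUnion_of_empty, iUnion_empty] at hT
    exact empty_ne_univ hT
  have hN : (0:ℝ) < T.card := by exact_mod_cast hTne.card_pos
  choose v hv0 hv using fun p => exists_chart_isoperimetric g p (mul_pos hK hN)
  have hex : ∀ᶠ w in 𝓝[>] (0:ℝ), ∀ p ∈ T, w ≤ v p :=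
    (eventually_all_finset T).2 fun p _ =>
      mem_of_superset (Ioo_mem_nhdsGT (hv0 p)) fun w hw => hw.2.le
  obtain ⟨w, hw, hw0⟩ := (hex.and self_mem_nhdsWithin).exists
  refine ⟨w, hw0, fun Ω hΩ hΩv => ?_⟩
  by_cases htop : boundaryMass g Ω univ = ⊤
  · rw [htop]; exact le_top
  rw [ENNReal.ofReal_le_iff_le_toReal htop]
  have h1 : ∀ p ∈ T, K * T.card * (vol g).real (Ω ∩ chartCube d p (cubeRadius d p)) ≤
      (boundaryMass g Ω univ).toReal := fun p hp => by
    rw [← ENNReal.ofReal_le_iff_le_toReal htop]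
    exact hv p Ω hΩ (hΩv.trans (hw p hp))
  have h2 := Finset.sum_le_sum h1
  rw [← Finset.mul_sum, Finset.sum_const, nsmul_eq_mul] at h2
  have h3 : (vol g).real Ω ≤ ∑ p ∈ T, (vol g).real (Ω ∩ chartCube d p (cubeRadius d p)) := by
    have h4 : Ω = ⋃ p ∈ T, Ω ∩ chartCube d p (cubeRadius d p) := by
      rw [← inter_iUnion₂, hT, inter_univ]
    conv_lhs => rw [h4]
    exact measureReal_biUnion_finset_le T _
  have h5 : K * T.card * (vol g).real Ω ≤ T.card * (boundaryMass g Ω univ).toReal :=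
    le_trans (by gcongr) h2
  refine le_of_mul_le_mul_left ?_ hN
  linarith

end Isoperimetric

/-! ### Positivity of the min-max value -/

section Positivity

variable {d : ℕ} {M : Type*} [TopologicalSpace M] [ChartedSpace (Model d) M]
  [IsManifold (𝓡 d) ∞ M] [MeasurableSpace M] [BorelSpace M] [T2Space M] [CompactSpace M]

/-- The volume is continuous along a path that is continuous in the flat topology. -/
lemma IsSweepout.continuous_vol {g : Metric d M} {φ : unitInterval → CaccioppoliSet g}
    (hφ : IsSweepout g φ) : Continuous fun t => (vol g).real (φ t).carrier := by
  rw [continuous_iff_continuousAt]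
  intro t
  have h1 : Tendsto (fun s => (flatDist (φ s) (φ t)).toReal) (𝓝 t) (𝓝 0) := by
    have h2 := (ENNReal.tendsto_toReal ENNReal.zero_ne_top).comp (hφ.flat_continuous t)
    rwa [ENNReal.toReal_zero] at h2
  rw [ContinuousAt, tendsto_iff_dist_tendsto_zero]
  refine squeeze_zero (fun _ => dist_nonneg) (fun s => ?_) h1
  rw [Real.dist_eq]
  have hle : ∀ A B : Set M, (vol g).real A - (vol g).real B ≤ (vol g).real (symmDiff A B) := by
    intro A B
    have h2 : A ⊆ B ∪ symmDiff A B := fun x hx => by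
      by_cases h : x ∈ B
      · exact Or.inl h
      · exact Or.inr (Or.inl ⟨hx, h⟩)
    have h3 := (measureReal_mono (μ := vol g) h2).trans (measureReal_union_le _ _)
    linarith
  refine abs_sub_le_iff.2 ⟨hle _ _, ?_⟩
  have := hle (φ t).carrier (φ s).carrier
  rwa [symmDiff_comm] at this

lemma minMaxValue_pos [Nonempty M] (g : Metric d M) {c : ℝ} (hc : 0 < c) :
    0 < minMaxValue g c := by
  obtain ⟨v, hv, hiso⟩ := exists_isoperimetric g (K := c + 1) (by positivity)
  have hV : 0 < (vol g).real univ := ENNReal.toReal_pos (vol_univ_pos g).ne' (measure_ne_top _ _)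
  set w := min v ((vol g).real univ) with hw
  have hw0 : 0 < w := lt_min hv hV
  refine lt_of_lt_of_le (EReal.coe_pos.2 hw0) (le_iInf₂ fun φ hφ => ?_)
  have h0 : (vol g).real (φ 0).carrier = 0 := by
    rw [measureReal_congr hφ.zero, measureReal_empty]
  have h1 : (vol g).real (φ 1).carrier = (vol g).real univ := measureReal_congr hφ.one
  obtain ⟨t, ht⟩ : w ∈ range fun t => (vol g).real (φ t).carrier :=
    mem_range_of_exists_le_of_exists_ge hφ.continuous_vol ⟨0, h0.le.trans hw0.le⟩
      ⟨1, (min_le_right _ _).trans h1.ge⟩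
  simp only at ht
  have h2 := hiso _ (φ t).measurableSet (ht.le.trans (min_le_left _ _))
  rw [ENNReal.ofReal_le_iff_le_toReal (φ t).finite_mass.ne, ht] at h2
  refine le_trans (EReal.coe_le_coe_iff.2 ?_)
    (le_iSup (fun t => (areaFunctional c (φ t) : EReal)) t)
  have h3 : (vol g (φ t).carrier).toReal = w := ht
  rw [areaFunctional, h3]
  linarith

end Positivity

/-! ### Cutoff functions of an interval -/

section Cutoff

/-- A smooth approximation of the indicator of `(-s, s)`, increasing and then decreasing; it tends
to the indicator as `k → ∞`. -/
noncomputable def cutoff (k s x : ℝ) : ℝ :=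
  Real.smoothTransition (k * (s - x)) * Real.smoothTransition (k * (s + x))

lemma contDiff_cutoff (k s : ℝ) : ContDiff ℝ ∞ (cutoff k s) :=
  (Real.smoothTransition.contDiff.comp (contDiff_const.mul (contDiff_const.sub contDiff_id))).mul
    (Real.smoothTransition.contDiff.comp (contDiff_const.mul (contDiff_const.add contDiff_id)))

lemma cutoff_nonneg (k s x : ℝ) : 0 ≤ cutoff k s x :=
  mul_nonneg (Real.smoothTransition.nonneg _) (Real.smoothTransition.nonneg _)

lemma cutoff_le_one (k s x : ℝ) : cutoff k s x ≤ 1 :=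
  mul_le_one₀ (Real.smoothTransition.le_one _) (Real.smoothTransition.nonneg _)
    (Real.smoothTransition.le_one _)

lemma cutoff_eq_zero {k s x : ℝ} (hk : 0 ≤ k) (hx : s ≤ |x|) : cutoff k s x = 0 := by
  rcases le_abs.1 hx with h | h
  · rw [cutoff, Real.smoothTransition.zero_of_nonpos (mul_nonpos_of_nonneg_of_nonpos hk
      (by linarith)), zero_mul]
  · rw [cutoff, Real.smoothTransition.zero_of_nonpos (x := k * (s + x))
      (mul_nonpos_of_nonneg_of_nonpos hk (by linarith)), mul_zero]

lemma tendsto_cutoff {s x : ℝ} (hx : |x| < s) :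
    Tendsto (fun k : ℕ => cutoff k s x) atTop (𝓝 1) := by
  have h := abs_lt.1 hx
  have hev : ∀ a : ℝ, 0 < a → ∀ᶠ k : ℕ in atTop, Real.smoothTransition (k * a) = 1 := by
    intro a ha
    filter_upwards [(tendsto_natCast_atTop_atTop.atTop_mul_const ha).eventually_ge_atTop 1]
      with k hk using Real.smoothTransition.one_of_one_le hk
  refine tendsto_const_nhds.congr' ?_
  filter_upwards [hev (s - x) (by linarith), hev (s + x) (by linarith)] with k h1 h2
  rw [cutoff, h1, h2, one_mul]

/-- The total variation of the cutoff is at most `2`. -/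
lemma integral_abs_deriv_cutoff_le {k : ℝ} (hk : 0 ≤ k) (s c : ℝ) {a b : ℝ} (hab : a ≤ b) :
    ∫ x in Icc a b, |deriv (cutoff k s) (x - c)| ≤ 2 := by
  set T := Real.smoothTransition with hT
  have hTs : ContDiff ℝ ∞ T := Real.smoothTransition.contDiff
  have hTd : ∀ x, HasDerivAt T (deriv T x) x := fun x =>
    (hTs.differentiable (by simp) x).hasDerivAt
  have hTc : Continuous (deriv T) := hTs.continuous_deriv (by simp)
  have hTm : ∀ x, 0 ≤ deriv T x := fun x => Real.smoothTransition.monotone.deriv_nonneg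
  set α : ℝ → ℝ := fun x => T (k * (s - (x - c))) with hα
  set β : ℝ → ℝ := fun x => T (k * (s + (x - c))) with hβ
  have hαd : ∀ x, HasDerivAt α (- (k * deriv T (k * (s - (x - c))))) x := fun x => by
    have h1 : HasDerivAt (fun x : ℝ => k * (s - (x - c))) (k * (-1)) x :=
      (((hasDerivAt_id x).sub_const c).const_sub s).const_mul k
    exact ((hTd _).comp x h1).congr_deriv (by ring)
  have hβd : ∀ x, HasDerivAt β (k * deriv T (k * (s + (x - c)))) x := fun x => by
    have h1 : HasDerivAt (fun x : ℝ => k * (s + (x - c))) (k * 1) x :=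
      (((hasDerivAt_id x).sub_const c).const_add s).const_mul k
    exact ((hTd _).comp x h1).congr_deriv (by ring)
  have hα' : Continuous fun x => k * deriv T (k * (s - (x - c))) := by fun_prop
  have hβ' : Continuous fun x => k * deriv T (k * (s + (x - c))) := by fun_prop
  have h0 : ∀ x, 0 ≤ T x := Real.smoothTransition.nonneg
  have h1 : ∀ x, T x ≤ 1 := Real.smoothTransition.le_one
  have hder : ∀ x, |deriv (cutoff k s) (x - c)| ≤
      k * deriv T (k * (s - (x - c))) + k * deriv T (k * (s + (x - c))) := by
    intro x
    have h2 : HasDerivAt (fun x => cutoff k s (x - c)) (deriv (cutoff k s) (x - c)) x := by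
      have := ((contDiff_cutoff k s).differentiable (by simp) (x - c)).hasDerivAt
      have h3 : HasDerivAt (fun x : ℝ => x - c) 1 x := (hasDerivAt_id x).sub_const c
      exact (this.comp x h3).congr_deriv (mul_one _)
    rw [h2.unique ((hαd x).mul (hβd x))]
    refine (abs_add_le _ _).trans (add_le_add ?_ ?_)
    · rw [abs_mul, abs_neg, abs_of_nonneg (mul_nonneg hk (hTm _)), abs_of_nonneg (h0 _)]
      exact mul_le_of_le_one_right (mul_nonneg hk (hTm _)) (h1 _)
    · rw [abs_mul, abs_of_nonneg (mul_nonneg hk (hTm _)), abs_of_nonneg (h0 _)]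
      exact mul_le_of_le_one_left (mul_nonneg hk (hTm _)) (h1 _)
  have hcc : Continuous fun x => |deriv (cutoff k s) (x - c)| :=
    (((contDiff_cutoff k s).continuous_deriv (by simp)).comp (continuous_id.sub
      continuous_const)).abs
  calc ∫ x in Icc a b, |deriv (cutoff k s) (x - c)|
      = ∫ x in a..b, |deriv (cutoff k s) (x - c)| := by
        rw [intervalIntegral.integral_of_le hab, integral_Icc_eq_integral_Ioc]
    _ ≤ ∫ x in a..b, (k * deriv T (k * (s - (x - c))) + k * deriv T (k * (s + (x - c)))) :=
        intervalIntegral.integral_mono hab (hcc.intervalIntegrable _ _)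
          ((hα'.add hβ').intervalIntegrable _ _) hder
    _ = (α a - α b) + (β b - β a) := by
        rw [intervalIntegral.integral_add (hα'.intervalIntegrable _ _)
          (hβ'.intervalIntegrable _ _), intervalIntegral.integral_eq_sub_of_hasDerivAt
          (fun x _ => hβd x) (hβ'.intervalIntegrable _ _)]
        have h3 := intervalIntegral.integral_eq_sub_of_hasDerivAt (a := a) (b := b)
          (fun x _ => hαd x) (hα'.neg.intervalIntegrable _ _)
        rw [intervalIntegral.integral_neg] at h3
        linarith
    _ ≤ 2 := by
        have := h1 (k * (s - (a - c)))
        have := h1 (k * (s + (b - c)))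
        have := h0 (k * (s - (b - c)))
        have := h0 (k * (s + (a - c)))
        simp only [hα, hβ]
        linarith

end Cutoff

/-! ### Cutoff functions of a cube -/

section CubeCutoff

variable {d : ℕ}

/-- A smooth approximation of the indicator of the open cube with centre `c` and half-side `s`. -/
noncomputable def cubeCutoff (k : ℝ) (c : Model d) (s : ℝ) (y : Model d) : ℝ :=
  ∏ i, cutoff k s (y i - c i)

lemma contDiff_cubeCutoff (k : ℝ) (c : Model d) (s : ℝ) : ContDiff ℝ ∞ (cubeCutoff k c s) :=
  contDiff_prod fun i _ => (contDiff_cutoff k s).comp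
    ((EuclideanSpace.proj i : Model d →L[ℝ] ℝ).contDiff.sub contDiff_const)

lemma cubeCutoff_nonneg (k : ℝ) (c : Model d) (s : ℝ) (y : Model d) : 0 ≤ cubeCutoff k c s y :=
  Finset.prod_nonneg fun _ _ => cutoff_nonneg _ _ _

lemma cubeCutoff_le_one (k : ℝ) (c : Model d) (s : ℝ) (y : Model d) : cubeCutoff k c s y ≤ 1 :=
  Finset.prod_le_one (fun _ _ => cutoff_nonneg _ _ _) fun _ _ => cutoff_le_one _ _ _

lemma cubeCutoff_eq_zero {k : ℝ} (hk : 0 ≤ k) {c : Model d} {s : ℝ} (hs : 0 < s) {y : Model d}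
    (hy : y ∉ cube c s) : cubeCutoff k c s y = 0 := by
  rw [mem_cube hs] at hy
  push Not at hy
  obtain ⟨i, hi⟩ := hy
  exact Finset.prod_eq_zero (Finset.mem_univ i) (cutoff_eq_zero hk hi)

lemma tendsto_cubeCutoff {c : Model d} {s : ℝ} (hs : 0 < s) (y : Model d) :
    Tendsto (fun k : ℕ => cubeCutoff k c s y) atTop (𝓝 ((cube c s).indicator 1 y)) := by
  by_cases hy : y ∈ cube c s
  · rw [indicator_of_mem hy]
    have h := tendsto_finsetProd Finset.univ fun i _ => tendsto_cutoff ((mem_cube hs).1 hy i)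
    rw [Finset.prod_const_one] at h
    exact h
  · rw [indicator_of_notMem hy]
    simp only [cubeCutoff_eq_zero (Nat.cast_nonneg _) hs hy]
    exact tendsto_const_nhds

lemma abs_fderiv_cubeCutoff_le (k : ℝ) (c : Model d) (s : ℝ) (y : Model d) {v : Model d} {C : ℝ}
    (hv : ∀ i, |v i| ≤ C) :
    |fderiv ℝ (cubeCutoff k c s) y v| ≤ C * ∑ i, |deriv (cutoff k s) (y i - c i)| := by
  have h1 : ∀ i : Fin d, HasFDerivAt (fun y : Model d => cutoff k s (y i - c i))
      (deriv (cutoff k s) (y i - c i) • (EuclideanSpace.proj i : Model d →L[ℝ] ℝ)) y := by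
    intro i
    have h2 := ((contDiff_cutoff k s).differentiable (by simp) (y i - c i)).hasDerivAt
    have h3 : HasFDerivAt (fun y : Model d => y i - c i)
        (EuclideanSpace.proj i : Model d →L[ℝ] ℝ) y :=
      (EuclideanSpace.proj i : Model d →L[ℝ] ℝ).hasFDerivAt.sub_const (c i)
    exact h2.comp_hasFDerivAt y h3
  have h4 := HasFDerivAt.finsetProd (u := Finset.univ) fun i _ => h1 i
  have h5 : fderiv ℝ (cubeCutoff k c s) y = _ := h4.fderiv
  rw [h5, FunLike.coe_sum, Finset.sum_apply, Finset.mul_sum]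
  refine (Finset.abs_sum_le_sum_abs _ _).trans (Finset.sum_le_sum fun i _ => ?_)
  have h6 : |∏ j ∈ Finset.univ.erase i, cutoff k s (y j - c j)| ≤ 1 := by
    rw [abs_of_nonneg (Finset.prod_nonneg fun _ _ => cutoff_nonneg _ _ _)]
    exact Finset.prod_le_one (fun _ _ => cutoff_nonneg _ _ _) fun _ _ => cutoff_le_one _ _ _
  simp only [smul_apply, smul_eq_mul, abs_mul, PiLp.proj_apply]
  calc _ ≤ 1 * (|deriv (cutoff k s) (y i - c i)| * C) := by
        gcongr
        exact hv i
    _ = _ := by ring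

/-- Fubini's theorem on a cube, for a function of one coordinate. -/
lemma setIntegral_closedCube_coord (z : Model d) {δ : ℝ} (hδ : 0 ≤ δ) (i : Fin d) (f : ℝ → ℝ) :
    ∫ y in closedCube z δ, f (y i) =
      (2 * δ) ^ (d - 1) * ∫ x in Icc (z i - δ) (z i + δ), f x := by
  classical
  set I : Fin d → Set ℝ := fun j => Icc (z j - δ) (z j + δ) with hI
  set F : Fin d → ℝ → ℝ := fun j x => (I j).indicator (if j = i then f else 1) x with hF
  have hmem : ∀ y : Model d, y ∈ closedCube z δ ↔ ∀ j, y j ∈ I j := by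
    intro y
    rw [mem_closedCube hδ]
    refine forall_congr' fun j => ?_
    rw [abs_le, hI, mem_Icc]
    constructor <;> rintro ⟨h1, h2⟩ <;> constructor <;> linarith
  have h1 : ∀ y : Model d, (closedCube z δ).indicator (fun y => f (y i)) y = ∏ j, F j (y j) := by
    intro y
    by_cases hy : y ∈ closedCube z δ
    · rw [indicator_of_mem hy]
      have hy' := (hmem y).1 hy
      rw [Finset.prod_eq_single i]
      · rw [hF]; simp [indicator_of_mem (hy' i)]
      · intro j _ hj
        rw [hF]; simp [indicator_of_mem (hy' j), hj]
      · simp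
    · rw [indicator_of_notMem hy]
      rw [hmem] at hy
      push Not at hy
      obtain ⟨j, hj⟩ := hy
      exact (Finset.prod_eq_zero (Finset.mem_univ j) (indicator_of_notMem hj _)).symm
  have h2 : ∫ y : Model d, ∏ j, F j (y j) = ∫ x : Fin d → ℝ, ∏ j, F j (x j) :=
    (EuclideanSpace.volume_preserving_symm_measurableEquiv_toLp (Fin d)).integral_comp'
      (fun x : Fin d → ℝ => ∏ j, F j (x j))
  rw [← integral_indicator (isClosed_closedCube z δ).measurableSet]
  simp only [h1]
  rw [h2, integral_fintype_prod_volume_eq_prod, ← Finset.mul_prod_erase _ _ (Finset.mem_univ i),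
    mul_comm]
  congr 1
  · rw [Finset.prod_congr rfl (g := fun _ => 2 * δ), Finset.prod_const, Finset.card_erase_of_mem
      (Finset.mem_univ i), Finset.card_univ, Fintype.card_fin]
    intro j hj
    have : F j = (I j).indicator 1 := by rw [hF]; simp [Finset.ne_of_mem_erase hj]
    rw [this, integral_indicator_one measurableSet_Icc, Measure.real, Real.volume_Icc,
      ENNReal.toReal_ofReal (by linarith)]
    ring
  · have : F i = (I i).indicator f := by rw [hF]; simp
    rw [this, integral_indicator measurableSet_Icc]

lemma integral_sum_abs_deriv_cutoff_le {k : ℝ} (hk : 0 ≤ k) (c z : Model d) (s : ℝ) {δ : ℝ}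
    (hδ : 0 ≤ δ) :
    ∫ y in closedCube z δ, ∑ i, |deriv (cutoff k s) (y i - c i)| ≤ 2 * d * (2 * δ) ^ (d - 1) := by
  have hcont : ∀ i : Fin d, Continuous fun y : Model d => |deriv (cutoff k s) (y i - c i)| :=
    fun i => (((contDiff_cutoff k s).continuous_deriv (by simp)).comp
      ((EuclideanSpace.proj i : Model d →L[ℝ] ℝ).continuous.sub continuous_const)).abs
  rw [integral_finsetSum _ fun i _ =>
    (hcont i).continuousOn.integrableOn_compact (isCompact_closedCube z δ)]
  calc _ ≤ ∑ _i : Fin d, (2 * δ) ^ (d - 1) * 2 := by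
        refine Finset.sum_le_sum fun i _ => ?_
        rw [setIntegral_closedCube_coord z hδ i fun x => |deriv (cutoff k s) (x - c i)|]
        exact mul_le_mul_of_nonneg_left
          (integral_abs_deriv_cutoff_le hk s (c i) (by linarith)) (by positivity)
    _ = _ := by simp; ring

end CubeCutoff

/-! ### Adding a coordinate cube to a set -/

section UnionWithCube

variable {d : ℕ} {M : Type*} [TopologicalSpace M] [ChartedSpace (Model d) M]
  [IsManifold (𝓡 d) ∞ M] [MeasurableSpace M] [BorelSpace M] [T2Space M] [CompactSpace M]

local notation "φ[" p "]" => chartAt (Model d) p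

lemma metricForm_smul (g : Metric d M) (q : M) (a : ℝ) (v : Model d) :
    metricForm g q (a • v) (a • v) = a ^ 2 * metricForm g q v v := by
  rw [map_smul, map_smul, smul_apply, smul_eq_mul, smul_eq_mul]; ring

/-- The integral of `|X u|` for a cutoff function `u` of a coordinate cube bounds the area of the
part of the boundary of the cube that lies in the support of `X`. -/
lemma integral_abs_dirDeriv_le (g : Metric d M) (p : M) {Λ C : ℝ} (hΛ0 : 0 ≤ Λ) (hC0 : 0 ≤ C)
    (hΛ : ∀ y ∈ closedCube (φ[p] p) (2 * cubeRadius d p), density g p y ≤ Λ)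
    (hC : ∀ y ∈ closedCube (φ[p] p) (2 * cubeRadius d p), ∀ v : Model d,
      metricForm g ((φ[p]).symm y) (pushMap p y v) (pushMap p y v) ≤ 1 → ∀ i, |v i| ≤ C)
    {k s δ : ℝ} (hk : 0 ≤ k) (hs : s ≤ cubeRadius d p) (hδ : 0 ≤ δ) {z : Model d} {U : Set M}
    (hU : ∀ q ∈ (φ[p]).source, q ∈ U → φ[p] q ∈ closedCube (φ[p] p) (cubeRadius d p) →
      φ[p] q ∈ closedCube z δ)
    {u : M → ℝ} (hu : ContMDiff (𝓡 d) 𝓘(ℝ) ∞ u)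
    (hus : ∀ q ∈ (φ[p]).source, u q = cubeCutoff k (φ[p] p) s (φ[p] q))
    (hu0 : ∀ q ∉ (φ[p]).symm '' closedCube (φ[p] p) s, u q = 0)
    {X : VField d M} (hX : X ∈ testFields g U) :
    ∫ q, |dirDeriv u X q| ∂(vol g) ≤ Λ * C * (2 * d) * (2 * δ) ^ (d - 1) := by
  have hR := cubeRadius_pos (d := d) p
  set c := φ[p] p with hc
  have hKt : closedCube c s ⊆ (φ[p]).target := closedCube_subset_target p (by linarith)
  have hsrc := (φ[p]).open_source.measurableSet
  have hcl := (isCompact_chart_symm_image p (isCompact_closedCube c s) hKt).isClosed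
  have hd0 : ∀ q ∉ (φ[p]).symm '' closedCube c s, dirDeriv u X q = 0 := fun q hq =>
    dirDeriv_eq_zero (by filter_upwards [hcl.isOpen_compl.mem_nhds hq] with z hz using hu0 z hz)
  have h1 : ∫ q, |dirDeriv u X q| ∂(vol g) =
      ∫ q in (φ[p]).source, |dirDeriv u X q| ∂(vol g) := by
    refine (setIntegral_eq_integral_of_forall_compl_eq_zero fun q hq => ?_).symm
    rw [hd0 q, abs_zero]
    rintro ⟨y, hy, rfl⟩
    exact hq ((φ[p]).map_target (hKt hy))
  have h2 : (φ[p]).target ∩ (φ[p]).symm ⁻¹' (φ[p]).source = (φ[p]).target :=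
    inter_eq_left.2 fun y hy => (φ[p]).map_target hy
  set G : Model d → ℝ := fun y => Λ * C * ∑ i, |deriv (cutoff k s) (y i - c i)| with hG
  have hG0 : ∀ y, 0 ≤ G y := fun y => by
    have : 0 ≤ ∑ i, |deriv (cutoff k s) (y i - c i)| := Finset.sum_nonneg fun _ _ => abs_nonneg _
    positivity
  have hGc : Continuous G := by
    refine continuous_const.mul (continuous_finsetSum _ fun i _ => ?_)
    exact (((contDiff_cutoff k s).continuous_deriv (by simp)).comp
      ((EuclideanSpace.proj i : Model d →L[ℝ] ℝ).continuous.sub continuous_const)).abs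
  have hzm := (isClosed_closedCube z δ).measurableSet
  have hGi : Integrable ((closedCube z δ).indicator G) :=
    (hGc.continuousOn.integrableOn_compact (isCompact_closedCube z δ)).integrable_indicator hzm
  have hGi0 : ∀ y, 0 ≤ (closedCube z δ).indicator G y := fun y =>
    indicator_nonneg (fun y _ => hG0 y) y
  have hpt : ∀ y ∈ (φ[p]).target,
      density g p y * |dirDeriv u X ((φ[p]).symm y)| ≤ (closedCube z δ).indicator G y := by
    intro y hy
    have hq := (φ[p]).map_target hy
    have hφq := (φ[p]).right_inv hy
    by_cases hyK : y ∈ closedCube c s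
    · have hyR : y ∈ closedCube c (cubeRadius d p) := closedCube_subset_closedCube c hs hyK
      have hy2 : y ∈ closedCube c (2 * cubeRadius d p) :=
        closedCube_subset_closedCube c (by linarith) hyR
      rw [dirDeriv_chart g hu X p hy]
      have hpush : pushMap p y (coordField X p y) = X ((φ[p]).symm y) := by
        have h := pushMap_coordField X p hq
        rw [hφq] at h
        exact h
      by_cases hXq : (X ((φ[p]).symm y) : Model d) = 0
      · have h3 : coordField X p y = 0 := by
          refine Eq.trans (congrArg (pullMap p ((φ[p]).symm y)) hXq) ?_
          exact map_zero _
        rw [h3, map_zero, abs_zero, mul_zero]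
        exact hGi0 y
      · have hqU : (φ[p]).symm y ∈ U := hX.2.1 (subset_tsupport _ hXq)
        have hyz : y ∈ closedCube z δ := by
          have := hU _ hq hqU
          rw [hφq] at this
          exact this hyR
        rw [indicator_of_mem hyz]
        have h3 : (fun w => u ((φ[p]).symm w)) =ᶠ[𝓝 y] cubeCutoff k c s := by
          filter_upwards [(φ[p]).open_target.mem_nhds hy] with w hw
          rw [hus _ ((φ[p]).map_target hw), (φ[p]).right_inv hw]
        rw [h3.fderiv_eq]
        have h4 := abs_fderiv_cubeCutoff_le k c s y (hC y hy2 (coordField X p y) (by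
          rw [hpush]; exact hX.2.2 _))
        calc density g p y * |fderiv ℝ (cubeCutoff k c s) y (coordField X p y)|
            ≤ Λ * (C * ∑ i, |deriv (cutoff k s) (y i - c i)|) :=
              mul_le_mul (hΛ y hy2) h4 (abs_nonneg _) hΛ0
          _ = G y := by rw [hG]; ring
    · rw [hd0, abs_zero, mul_zero]
      · exact hGi0 y
      · rintro ⟨w, hw, hwy⟩
        have := (φ[p]).symm.injOn (hKt hw) hy hwy
        exact hyK (this ▸ hw)
  rw [h1, setIntegral_vol g p hsrc Subset.rfl (continuous_dirDeriv g hu X).abs.stronglyMeasurable,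
    h2]
  have htm := (φ[p]).open_target.measurableSet
  calc ∫ y in (φ[p]).target, density g p y * |dirDeriv u X ((φ[p]).symm y)|
      ≤ ∫ y in (φ[p]).target, (closedCube z δ).indicator G y :=
        integral_mono_of_nonneg ((ae_restrict_iff' htm).2 (ae_of_all _ fun y hy =>
          mul_nonneg (density_pos g p hy).le (abs_nonneg _))) hGi.integrableOn
          ((ae_restrict_iff' htm).2 (ae_of_all _ hpt))
    _ ≤ ∫ y, (closedCube z δ).indicator G y :=
        setIntegral_le_integral hGi (ae_of_all _ hGi0)
    _ = Λ * C * ∫ y in closedCube z δ, ∑ i, |deriv (cutoff k s) (y i - c i)| := by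
        rw [integral_indicator hzm, hG, integral_const_mul]
    _ ≤ Λ * C * (2 * d * (2 * δ) ^ (d - 1)) :=
        mul_le_mul_of_nonneg_left (integral_sum_abs_deriv_cutoff_le hk c z s hδ) (by positivity)
    _ = _ := by ring

/-- Adding a coordinate cube to a set increases the mass of its boundary in `U` at most by the
area of the part of the boundary of the cube that lies in `U`. -/
lemma exists_boundaryMass_union_le (g : Metric d M) (p : M) :
    ∃ B : ℝ, 0 ≤ B ∧ ∀ (A : Set M), MeasurableSet A → ∀ (s δ : ℝ), s ≤ cubeRadius d p → 0 ≤ δ →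
      ∀ (z : Model d) (U : Set M),
      (∀ q ∈ (φ[p]).source, q ∈ U → φ[p] q ∈ closedCube (φ[p] p) (cubeRadius d p) →
        φ[p] q ∈ closedCube z δ) →
      boundaryMass g (A ∪ chartCube d p s) U ≤
        boundaryMass g A U + ENNReal.ofReal (B * (2 * δ) ^ (d - 1)) := by
  obtain ⟨m, Λ, -, hΛ, hb⟩ := exists_density_bounds g p
  obtain ⟨C, hC, hCb⟩ := exists_coord_le g p
  refine ⟨Λ * C * (2 * d), by positivity, fun A hA s δ hsR hδ z U hU => ?_⟩
  rcases le_or_gt s 0 with hs | hs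
  · rw [chartCube_eq_empty p hs, union_empty]
    exact le_self_add
  have hR := cubeRadius_pos (d := d) p
  set c := φ[p] p with hc
  have hK := isCompact_closedCube c s
  have hKt : closedCube c s ⊆ (φ[p]).target := closedCube_subset_target p (by linarith)
  set Q := chartCube d p s with hQ
  have hQm : MeasurableSet Q := (isOpen_chartCube p s).measurableSet
  have hex : ∀ k : ℕ, ∃ u : M → ℝ, ContMDiff (𝓡 d) 𝓘(ℝ) ∞ u ∧
      (∀ q ∈ (φ[p]).source, u q = cubeCutoff k c s (φ[p] q)) ∧
      ∀ q ∉ (φ[p]).symm '' closedCube c s, u q = 0 := fun k =>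
    exists_contMDiff_of_coord p (contDiff_cubeCutoff k c s) hK hKt fun y hy =>
      cubeCutoff_eq_zero (Nat.cast_nonneg k) hs fun h => hy (cube_subset_closedCube _ _ h)
  choose u hu hus hu0 using hex
  have h01 : ∀ k q, 0 ≤ u k q ∧ u k q ≤ 1 := by
    intro k q
    by_cases hq : q ∈ (φ[p]).source
    · rw [hus k q hq]
      exact ⟨cubeCutoff_nonneg _ _ _ _, cubeCutoff_le_one _ _ _ _⟩
    · rw [hu0 k q]
      · simp
      · rintro ⟨y, hy, rfl⟩
        exact hq ((φ[p]).map_target (hKt hy))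
  have hlim : ∀ q, Tendsto (fun k => u k q) atTop (𝓝 (Q.indicator 1 q)) := by
    intro q
    by_cases hq : q ∈ (φ[p]).source
    · simp only [hus _ q hq]
      have h := tendsto_cubeCutoff (c := c) hs (φ[p] q)
      have h2 : Q.indicator (1 : M → ℝ) q = (cube c s).indicator 1 (φ[p] q) := by
        by_cases h3 : φ[p] q ∈ cube c s
        · rw [indicator_of_mem h3, indicator_of_mem (show q ∈ Q from ⟨hq, h3⟩)]; rfl
        · rw [indicator_of_notMem h3, indicator_of_notMem fun h : q ∈ Q => h3 h.2]
      rwa [h2]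
    · have h2 : ∀ k, u k q = 0 := fun k => hu0 k q (by
        rintro ⟨y, hy, rfl⟩
        exact hq ((φ[p]).map_target (hKt hy)))
      rw [indicator_of_notMem fun h : q ∈ Q => hq h.1]
      simp only [h2]
      exact tendsto_const_nhds
  refine iSup₂_le fun X hX => ?_
  have hdc := continuous_divergence g X
  have hci : ∀ {f : M → ℝ}, Continuous f → Integrable f (vol g) := fun hf =>
    hf.integrable_of_hasCompactSupport (HasCompactSupport.of_compactSpace _)
  -- The left-hand side converges to the flux of `X` out of `A ∪ Q`. On the right is the flux out of
  -- `A` of the test field `(1 - u k) X`, with an error that is bounded by the integral of `|X (u k)|`.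
  have hstep : ∀ k : ℕ, (∫ q in A, (1 - u k q) * divergence g X q ∂(vol g)) +
      ∫ q, u k q * divergence g X q ∂(vol g) ≤
        (∫ q in A, divergence g (mulField (fun q => 1 - u k q) (contMDiff_const.sub (hu k)) X) q
          ∂(vol g)) + Λ * C * (2 * d) * (2 * δ) ^ (d - 1) := by
    intro k
    have h1 : ∫ q, divergence g (mulField (u k) (hu k) X) q ∂(vol g) = 0 :=
      integral_divergence_eq_zero g _ p hK hKt fun q hq => by
        rw [mulField_apply, hu0 k q hq, zero_smul]
    have hdd := continuous_dirDeriv g (hu k) X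
    have huc : Continuous (u k) := (hu k).continuous
    simp only [divergence_mulField_eq, dirDeriv_one_sub] at h1 ⊢
    have hi2 : Integrable (fun q => u k q * divergence g X q) (vol g) := hci (huc.mul hdc)
    rw [integral_add hi2 (hci hdd)] at h1
    have hi1 : Integrable (fun q => (1 - u k q) * divergence g X q) (vol g) :=
      hci ((continuous_const.sub huc).mul hdc)
    have hi3 : Integrable (fun q => -dirDeriv (u k) X q) (vol g) := hci hdd.neg
    rw [integral_add hi1.integrableOn hi3.integrableOn, integral_neg]
    have h2 := integral_abs_dirDeriv_le g p hΛ.le hC.le (fun y hy => (hb y hy).2) hCb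
      (Nat.cast_nonneg k) hsR hδ hU (hu k) (hus k) (hu0 k) hX
    -- As `u k X` has no flux out of `M`, only the derivative of `u k` outside `A` remains.
    have h3 : (∫ q in A, dirDeriv (u k) X q ∂(vol g)) - ∫ q, dirDeriv (u k) X q ∂(vol g) ≤
        ∫ q, |dirDeriv (u k) X q| ∂(vol g) := by
      rw [← integral_add_compl hA (hci hdd), sub_add_cancel_left, ← integral_neg]
      calc ∫ q in Aᶜ, -dirDeriv (u k) X q ∂(vol g)
          ≤ ∫ q in Aᶜ, |dirDeriv (u k) X q| ∂(vol g) :=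
            setIntegral_mono (hci hdd.neg).integrableOn (hci hdd.abs).integrableOn
              fun q => neg_le_abs _
        _ ≤ _ := setIntegral_le_integral (hci hdd.abs) (ae_of_all _ fun q => abs_nonneg _)
    linarith
  have htest : ∀ k, mulField (fun q => 1 - u k q) (contMDiff_const.sub (hu k)) X ∈
      testFields g U := by
    intro k
    refine ⟨HasCompactSupport.of_compactSpace _, Subset.trans (closure_mono ?_) hX.2.1,
      fun q => ?_⟩
    · intro q hq hXq
      refine hq ?_
      have : (X q : Model d) = 0 := hXq
      change (1 - u k q) • (X q : Model d) = 0
      rw [this, smul_zero]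
    · have h1 : metricForm g q ((1 - u k q) • X q) ((1 - u k q) • X q) =
          (1 - u k q) ^ 2 * metricForm g q (X q) (X q) := metricForm_smul g q _ _
      refine h1.trans_le (mul_le_one₀ ?_ ?_ (hX.2.2 q))
      · exact pow_le_one₀ (by linarith [(h01 k q).2]) (by linarith [(h01 k q).1])
      · by_cases h0 : (X q : Model d) = 0
        · have : metricForm g q (X q) (X q) = 0 := by
            have h2 : metricForm g q (0 : Model d) (0 : Model d) = 0 := by simp
            exact (congrArg (fun v : Model d => metricForm g q v v) h0).trans h2
          exact this.ge
        · exact (metricForm_pos g q h0).le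
  have hconv : Tendsto (fun k => (∫ q in A, (1 - u k q) * divergence g X q ∂(vol g)) +
      ∫ q, u k q * divergence g X q ∂(vol g)) atTop
      (𝓝 (∫ q in A ∪ Q, divergence g X q ∂(vol g))) := by
    have h1 : Tendsto (fun k => ∫ q in A, (1 - u k q) * divergence g X q ∂(vol g)) atTop
        (𝓝 (∫ q in A, (1 - Q.indicator 1 q) * divergence g X q ∂(vol g))) := by
      refine tendsto_integral_of_dominated_convergence (fun q => |divergence g X q|)
        (fun k => ((continuous_const.sub (hu k).continuous).mul hdc).aestronglyMeasurable)
        (hci hdc.abs).integrableOn (fun k => ae_of_all _ fun q => ?_) (ae_of_all _ fun q =>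
          (tendsto_const_nhds.sub (hlim q)).mul_const _)
      rw [Real.norm_eq_abs, abs_mul, abs_of_nonneg (by linarith [(h01 k q).2])]
      exact mul_le_of_le_one_left (abs_nonneg _) (by linarith [(h01 k q).1])
    have h2 : Tendsto (fun k => ∫ q, u k q * divergence g X q ∂(vol g)) atTop
        (𝓝 (∫ q, Q.indicator 1 q * divergence g X q ∂(vol g))) := by
      refine tendsto_integral_of_dominated_convergence (fun q => |divergence g X q|)
        (fun k => ((hu k).continuous.mul hdc).aestronglyMeasurable)
        (hci hdc.abs) (fun k => ae_of_all _ fun q => ?_) (ae_of_all _ fun q =>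
          (hlim q).mul_const _)
      rw [Real.norm_eq_abs, abs_mul, abs_of_nonneg (h01 k q).1]
      exact mul_le_of_le_one_left (abs_nonneg _) (h01 k q).2
    have h3 : (fun q => (1 - Q.indicator 1 q) * divergence g X q) =
        Qᶜ.indicator (divergence g X) := by
      ext q
      by_cases hq : q ∈ Q <;> simp [hq]
    have h4 : (fun q => Q.indicator 1 q * divergence g X q) = Q.indicator (divergence g X) := by
      ext q
      by_cases hq : q ∈ Q <;> simp [hq]
    rw [h3, setIntegral_indicator hQm.compl] at h1
    rw [h4, integral_indicator hQm] at h2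
    have h5 : A ∪ Q = (A ∩ Qᶜ) ∪ Q := by
      rw [← Set.sdiff_eq, sdiff_union_self]
    rw [h5, setIntegral_union (disjoint_left.2 fun q hq => hq.2) hQm (hci hdc).integrableOn
      (hci hdc).integrableOn]
    exact h1.add h2
  by_cases htop : boundaryMass g A U = ⊤
  · rw [htop, top_add]; exact le_top
  have hb0 : 0 ≤ Λ * C * (2 * d) * (2 * δ) ^ (d - 1) := by positivity
  rw [← ENNReal.ofReal_toReal htop, ← ENNReal.ofReal_add ENNReal.toReal_nonneg hb0]
  refine ENNReal.ofReal_le_ofReal (le_of_tendsto' hconv fun k => (hstep k).trans ?_)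
  exact add_le_add_left ((ENNReal.ofReal_le_iff_le_toReal htop).1 (le_boundaryMass g (htest k))) _

end UnionWithCube

/-! ### Geodesic balls in a chart -/

section GeodesicBalls

variable {d : ℕ} {M : Type*} [TopologicalSpace M] [ChartedSpace (Model d) M]
  [IsManifold (𝓡 d) ∞ M] [T2Space M] [CompactSpace M]

local notation "φ[" p "]" => chartAt (Model d) p

/-- Small geodesic balls are small in a coordinate cube, uniformly in their centres. -/
lemma exists_geodesicBall_coord_le (g : Metric d M) (p : M) {δ : ℝ} (hδ : 0 < δ) :
    ∃ r > 0, ∀ x : M, ∀ q ∈ geodesicBall g x r, ∀ q' ∈ geodesicBall g x r,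
      q ∈ (φ[p]).source → q' ∈ (φ[p]).source →
      φ[p] q ∈ closedCube (φ[p] p) (cubeRadius d p) →
      φ[p] q' ∈ closedCube (φ[p] p) (cubeRadius d p) → φ[p] q ∈ closedCube (φ[p] q') δ := by
  let _ : Bundle.RiemannianBundle (fun x : M => TangentSpace (𝓡 d) x) := ⟨g.toRiemannianMetric⟩
  have _ : IsContinuousRiemannianBundle (Model d) (fun x : M => TangentSpace (𝓡 d) x) :=
    ⟨g.inner, g.contMDiff.continuous, fun _ _ _ => rfl⟩
  let _ : PseudoEMetricSpace M := .ofRiemannianMetric (𝓡 d) M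
  have hR := cubeRadius_pos (d := d) p
  have hKt : closedCube (φ[p] p) (cubeRadius d p) ⊆ (φ[p]).target :=
    closedCube_subset_target p (by linarith)
  have hK := isCompact_chart_symm_image p (isCompact_closedCube (φ[p] p) (cubeRadius d p)) hKt
  have huc : UniformContinuousOn φ[p] ((φ[p]).symm '' closedCube (φ[p] p) (cubeRadius d p)) :=
    hK.uniformContinuousOn_of_continuous ((φ[p]).continuousOn.mono (by
      rintro _ ⟨y, hy, rfl⟩
      exact (φ[p]).map_target (hKt hy)))
  rw [EMetric.uniformContinuousOn_iff] at huc
  obtain ⟨η, hη, h⟩ := huc (ENNReal.ofReal δ) (ENNReal.ofReal_pos.2 hδ)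
  obtain ⟨r, hr, hrη⟩ : ∃ r : ℝ, 0 < r ∧ ENNReal.ofReal r + ENNReal.ofReal r ≤ η := by
    have h1 : Tendsto (fun r : ℝ => ENNReal.ofReal r + ENNReal.ofReal r) (𝓝[>] 0) (𝓝 0) := by
      have h2 : Continuous fun r : ℝ => ENNReal.ofReal r + ENNReal.ofReal r :=
        ENNReal.continuous_ofReal.add ENNReal.continuous_ofReal
      exact (h2.tendsto' 0 0 (by simp)).mono_left nhdsWithin_le_nhds
    obtain ⟨r, h2, h3⟩ := ((h1.eventually (ge_mem_nhds hη)).and self_mem_nhdsWithin).exists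
    exact ⟨r, h3, h2⟩
  refine ⟨r, hr, fun x q hq q' hq' hs hs' hc hc' => ?_⟩
  have h1 : edist x q < ENNReal.ofReal r := hq
  have h2 : edist x q' < ENNReal.ofReal r := hq'
  have h3 : edist q q' < η := by
    refine lt_of_lt_of_le (lt_of_le_of_lt (edist_triangle_left q q' x) ?_) hrη
    exact ENNReal.add_lt_add h1 h2
  have h4 := h ⟨_, hc, (φ[p]).left_inv hs⟩ ⟨_, hc', (φ[p]).left_inv hs'⟩ h3
  rw [edist_dist, ENNReal.ofReal_lt_ofReal_iff hδ, dist_eq_norm] at h4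
  rw [mem_closedCube hδ.le]
  intro i
  exact (PiLp.norm_apply_le (φ[p] q - φ[p] q') i).trans h4.le

lemma geodesicBall_subset_geodesicBall (g : Metric d M) (x : M) {r r' : ℝ} (h : r ≤ r') :
    geodesicBall g x r ⊆ geodesicBall g x r' := fun _ hq =>
  lt_of_lt_of_le hq (ENNReal.ofReal_le_ofReal h)

end GeodesicBalls

/-! ### A sweepout by unions of coordinate cubes -/

section Sweepout

variable {d : ℕ} {M : Type*} [TopologicalSpace M] [ChartedSpace (Model d) M]

local notation "φ[" p "]" => chartAt (Model d) p

/-- The union of the coordinate cubes around the points of `T`, shrunk by the factor `t`. -/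
def cubeUnion (d : ℕ) {M : Type*} [TopologicalSpace M] [ChartedSpace (Model d) M] (T : Finset M)
    (t : ℝ) : Set M :=
  ⋃ p ∈ T, chartCube d p (t * cubeRadius d p)

lemma isOpen_cubeUnion (T : Finset M) (t : ℝ) : IsOpen (cubeUnion d T t) :=
  isOpen_biUnion fun p _ => isOpen_chartCube p _

variable [IsManifold (𝓡 d) ∞ M] [MeasurableSpace M] [BorelSpace M]

lemma vol_symmDiff_chartCube_le (g : Metric d M) (p : M) {Λ : ℝ} (hd : d ≠ 0)
    (hΛ : ∀ y ∈ closedCube (φ[p] p) (2 * cubeRadius d p), density g p y ≤ Λ) {a b : ℝ}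
    (ha : 0 ≤ a) (hb : 0 ≤ b) (haR : a ≤ 2 * cubeRadius d p) (hbR : b ≤ 2 * cubeRadius d p) :
    vol g (symmDiff (chartCube d p a) (chartCube d p b)) ≤
      ENNReal.ofReal Λ * ENNReal.ofReal |(2 * a) ^ d - (2 * b) ^ d| := by
  wlog hab : a ≤ b generalizing a b with H
  · rw [symmDiff_comm, abs_sub_comm]
    exact H hb ha hbR haR (le_of_not_ge hab)
  have hvol : ∀ r : ℝ, 0 ≤ r →
      volume (cube (φ[p] p) r) = ENNReal.ofReal ((2 * r) ^ d) := by
    intro r hr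
    rcases hr.eq_or_lt with rfl | hr
    · rw [cube, Metric.ball_zero, preimage_empty, measure_empty, mul_zero, zero_pow hd,
        ENNReal.ofReal_zero]
    · exact volume_cube _ hr
  have h1 : symmDiff (chartCube d p a) (chartCube d p b) = (chartCube d p a)ᶜ ∩ chartCube d p b := by
    rw [symmDiff_of_le (chartCube_subset_chartCube p hab), inter_comm]
    rfl
  rw [h1]
  refine (vol_inter_chartCube_le g p hΛ (isOpen_chartCube p a).measurableSet.compl hbR).trans ?_
  gcongr
  have h2 : (φ[p]).target ∩ (φ[p]).symm ⁻¹' (chartCube d p a)ᶜ ∩ cube (φ[p] p) b ⊆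
      cube (φ[p] p) b \ cube (φ[p] p) a := by
    rintro y ⟨⟨h3, h4⟩, h5⟩
    refine ⟨h5, fun h6 => h4 ⟨(φ[p]).map_target h3, ?_⟩⟩
    rwa [mem_preimage, (φ[p]).right_inv h3]
  refine (measure_mono h2).trans ?_
  have h7 : volume (cube (φ[p] p) a) ≠ ⊤ := by rw [hvol a ha]; exact ENNReal.ofReal_ne_top
  rw [measure_sdiff (cube_subset_cube _ hab) (isOpen_cube _ _).measurableSet.nullMeasurableSet h7,
    hvol a ha, hvol b hb, ← ENNReal.ofReal_sub _ (by positivity), abs_sub_comm]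
  exact ENNReal.ofReal_le_ofReal (le_abs_self _)

lemma tendsto_vol_symmDiff_cubeUnion (g : Metric d M) (hd : d ≠ 0) (T : Finset M)
    (t : unitInterval) :
    Tendsto (fun s : unitInterval => vol g (symmDiff (cubeUnion d T s) (cubeUnion d T t))) (𝓝 t)
      (𝓝 0) := by
  have hex : ∀ p : M, ∃ Λ : ℝ, ∀ y ∈ closedCube (φ[p] p) (2 * cubeRadius d p),
      density g p y ≤ Λ := fun p => by
    obtain ⟨m, Λ, -, -, h⟩ := exists_density_bounds g p
    exact ⟨Λ, fun y hy => (h y hy).2⟩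
  choose Λ hΛ using hex
  set F : unitInterval → ℝ≥0∞ := fun s => ∑ p ∈ T, ENNReal.ofReal (Λ p) * ENNReal.ofReal
    |(2 * (s * cubeRadius d p)) ^ d - (2 * (t * cubeRadius d p)) ^ d| with hF
  have h1 : Tendsto F (𝓝 t) (𝓝 0) := by
    have h2 : Continuous F := by
      refine continuous_finsetSum _ fun p _ => ?_
      refine (ENNReal.continuous_const_mul ENNReal.ofReal_ne_top).comp ?_
      exact ENNReal.continuous_ofReal.comp (by fun_prop)
    refine h2.tendsto' t 0 ?_
    simp [hF]
  refine tendsto_of_tendsto_of_tendsto_of_le_of_le tendsto_const_nhds h1 (fun _ => bot_le)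
    fun s => ?_
  have h3 : symmDiff (cubeUnion d T s) (cubeUnion d T t) ⊆ ⋃ p ∈ T,
      symmDiff (chartCube d p (s * cubeRadius d p)) (chartCube d p (t * cubeRadius d p)) := by
    intro q hq
    simp only [cubeUnion, mem_symmDiff, mem_iUnion, not_exists, exists_prop, not_and] at hq ⊢
    rcases hq with ⟨⟨p, hp, h⟩, h'⟩ | ⟨⟨p, hp, h⟩, h'⟩
    · exact ⟨p, hp, Or.inl ⟨h, h' p hp⟩⟩
    · exact ⟨p, hp, Or.inr ⟨h, h' p hp⟩⟩
  refine (measure_mono h3).trans ((measure_biUnion_finset_le _ _).trans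
    (Finset.sum_le_sum fun p _ => ?_))
  have hR := cubeRadius_pos (d := d) p
  have hle : ∀ s : unitInterval, (s : ℝ) * cubeRadius d p ≤ 2 * cubeRadius d p := fun s =>
    mul_le_mul_of_nonneg_right (s.2.2.trans one_le_two) hR.le
  exact vol_symmDiff_chartCube_le g p hd (hΛ p) (mul_nonneg s.2.1 hR.le)
    (mul_nonneg t.2.1 hR.le) (hle s) (hle t)

variable [T2Space M] [CompactSpace M]

/-- The mass in `U` of the boundary of a union of coordinate cubes, if `U` meets the cube around `p`
in a coordinate cube of half-side `δ p`. -/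
lemma exists_boundaryMass_cubeUnion_le (g : Metric d M) :
    ∃ B : M → ℝ, ∀ (T : Finset M) (t : unitInterval) (δ : M → ℝ) (U : Set M),
      (∀ p, 0 ≤ δ p) →
      (∀ p ∈ T, ∃ z : Model d, ∀ q ∈ (φ[p]).source, q ∈ U →
        φ[p] q ∈ closedCube (φ[p] p) (cubeRadius d p) → φ[p] q ∈ closedCube z (δ p)) →
      boundaryMass g (cubeUnion d T t) U ≤ ∑ p ∈ T, ENNReal.ofReal (B p * (2 * δ p) ^ (d - 1)) := by
  classical
  -- The cubes are added one by one.
  choose B hB0 hB using exists_boundaryMass_union_le g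
  refine ⟨B, fun T t δ U hδ => ?_⟩
  induction T using Finset.induction_on with
  | empty => simp [cubeUnion, boundaryMass]
  | insert p T hp ih =>
    intro h
    have h1 : cubeUnion d (insert p T) t =
        cubeUnion d T t ∪ chartCube d p (t * cubeRadius d p) := by
      rw [cubeUnion, Finset.set_biUnion_insert, union_comm]
      rfl
    obtain ⟨z, hz⟩ := h p (Finset.mem_insert_self p T)
    rw [h1, Finset.sum_insert hp, add_comm]
    refine (hB p _ (isOpen_cubeUnion T t).measurableSet _ (δ p)
      (mul_le_of_le_one_left (cubeRadius_pos p).le t.2.2) (hδ p) z U hz).trans ?_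
    exact add_le_add_left (ih fun p' hp' => h p' (Finset.mem_insert_of_mem hp')) _

/-- There is a sweepout whose boundaries have uniformly bounded mass. -/
lemma exists_isSweepout (g : Metric d M) (hd : 2 ≤ d) :
    ∃ φ : unitInterval → CaccioppoliSet g, IsSweepout g φ ∧
      ∃ K < ⊤, ∀ t, boundaryMass g (φ t).carrier univ ≤ K := by
  obtain ⟨T, hT⟩ := exists_finset_chartCube_cover d M
  obtain ⟨B, hB⟩ := exists_boundaryMass_cubeUnion_le g
  set K := ∑ p ∈ T, ENNReal.ofReal (B p * (2 * cubeRadius d p) ^ (d - 1)) with hKdef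
  have hK : K < ⊤ := ENNReal.sum_lt_top.2 fun p _ => ENNReal.ofReal_lt_top
  have hmass : ∀ t : unitInterval, boundaryMass g (cubeUnion d T t) univ ≤ K := fun t =>
    hB T t (cubeRadius d) univ (fun p => (cubeRadius_pos p).le) fun p _ =>
      ⟨φ[p] p, fun q _ _ h => h⟩
  refine ⟨fun t => ⟨cubeUnion d T t, (isOpen_cubeUnion T t).measurableSet,
    (hmass t).trans_lt hK⟩, ⟨?_, ?_, ?_, ?_⟩, K, hK, hmass⟩
  · exact fun t => tendsto_vol_symmDiff_cubeUnion g (by lia) T t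
  · have : cubeUnion d T (0 : unitInterval) = ∅ := by
      simp [cubeUnion, chartCube_eq_empty]
    exact this.eventuallyEq
  · have : cubeUnion d T (1 : unitInterval) = univ := by
      rw [← hT]
      simp [cubeUnion]
    exact this.eventuallyEq
  · rw [ENNReal.tendsto_nhds_zero]
    intro ε hε
    -- In the cubes, balls of small radius lie in cubes of half-side `δ`, which meet the boundary
    -- of each cube in an area of order `δ ^ (d - 1)`.
    obtain ⟨δ, hδε, hδ⟩ : ∃ δ : ℝ, ∑ p ∈ T, ENNReal.ofReal (B p * (2 * δ) ^ (d - 1)) ≤ ε ∧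
        0 < δ := by
      have h1 : Tendsto (fun δ : ℝ => ∑ p ∈ T, ENNReal.ofReal (B p * (2 * δ) ^ (d - 1)))
          (𝓝[>] 0) (𝓝 0) := by
        have h2 : Continuous fun δ : ℝ => ∑ p ∈ T, ENNReal.ofReal (B p * (2 * δ) ^ (d - 1)) :=
          continuous_finsetSum _ fun p _ => ENNReal.continuous_ofReal.comp (by fun_prop)
        refine (h2.tendsto' 0 0 ?_).mono_left nhdsWithin_le_nhds
        have h3 : d - 1 ≠ 0 := by lia
        simp [h3]
      exact ((h1.eventually (ge_mem_nhds hε)).and self_mem_nhdsWithin).exists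
    choose r hr hball using fun p => exists_geodesicBall_coord_le g p hδ
    have hev : ∀ᶠ ρ : ℝ in 𝓝[>] 0, ∀ p ∈ T, ρ ≤ r p :=
      (Filter.eventually_all_finset T).2 fun p _ =>
        nhdsWithin_le_nhds (ge_mem_nhds (hr p))
    filter_upwards [hev] with ρ hρ
    refine iSup₂_le fun x t => le_trans ?_ hδε
    refine hB T t (fun _ => δ) (geodesicBall g x ρ) (fun _ => hδ.le) fun p hp => ?_
    by_cases hne : ∃ q' ∈ geodesicBall g x ρ, q' ∈ (φ[p]).source ∧
        φ[p] q' ∈ closedCube (φ[p] p) (cubeRadius d p)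
    · obtain ⟨q', h1, h2, h3⟩ := hne
      have hsub := geodesicBall_subset_geodesicBall g x (hρ p hp)
      exact ⟨φ[p] q', fun q hq hqU hqc => hball p x q (hsub hqU) q' (hsub h1) hq h2 hqc h3⟩
    · exact ⟨0, fun q hq hqU hqc => absurd ⟨q, hqU, hq, hqc⟩ hne⟩

lemma minMaxValue_lt_top (g : Metric d M) (hd : 2 ≤ d) {c : ℝ} (hc : 0 ≤ c) :
    minMaxValue g c < ⊤ := by
  obtain ⟨φ, hφ, K, hK, hm⟩ := exists_isSweepout g hd
  refine (iInf₂_le φ hφ).trans_lt (lt_of_le_of_lt (iSup_le fun t => ?_)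
    (EReal.coe_lt_top K.toReal))
  refine EReal.coe_le_coe_iff.2 ?_
  have h1 := ENNReal.toReal_mono hK.ne (hm t)
  have h2 : 0 ≤ c * (vol g (φ t).carrier).toReal := mul_nonneg hc ENNReal.toReal_nonneg
  rw [areaFunctional]
  linarith

end Sweepout

end CMCMinMax

theorem proposition2p5 (n : ℕ) (hn : 3 ≤ n + 1) (hn' : n + 1 ≤ 7)
    (M : Type*) [TopologicalSpace M] [ChartedSpace (EuclideanSpace ℝ (Fin (n + 1))) M]
    [IsManifold (𝓡 (n + 1)) ∞ M] [T2Space M] [CompactSpace M] [Nonempty M]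
    [MeasurableSpace M] [BorelSpace M]
    (g : CMCMinMax.Metric (n + 1) M) (c : ℝ) (hc : 0 < c) :
    0 < CMCMinMax.minMaxValue g c ∧ CMCMinMax.minMaxValue g c < ⊤ :=
  ⟨CMCMinMax.minMaxValue_pos g hc, CMCMinMax.minMaxValue_lt_top g (by lia) hc.le⟩
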